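/- Let $\Omega\subset\mathbb{RP}^3$ be an open, properly convex, indecomposable domain that is not strictly convex, let $\Gamma<\mathrm{PSL}(4,\mathbb R)$ be a discrete torsion-free group preserving $\Omega$ and acting cocompactly on it, and let $M=\Omega/\Gamma$ (a Benoist 3-manifold). Let $SM=S\Omega/\Gamma$ be the unit tangent bundle for the Finsler norm of the Hilbert metric $d_\Omega(x,y)=\frac12|\log[a,x,y,b]|$, and let $\phi^t:SM\to SM$ be the geodesic flow, which moves unit vectors along projective lines at unit Hilbert speed. For a unit vector $v$ of $\Omega$ let $v^\pm\in\partial\Omega$ be the forward and backward endpoints of the projective line tangent to $v$. A point $\xi\in\partial\Omega$ is proper if $\Omega$ has a unique supporting hyperplane at $\xi$, and extremal if no open line segment contained in $\partial\Omega$ contains $\xi$. A vector of $SM$ is forward (backward) regular if, for a lift $v$ to $S\Omega$, the point $v^+$ (respectively $v^-$) is a proper extremal point. Let $d$ be any metric on $SM$ that induces its topology, and for $v\in SM$, $\epsilon>0$ put $$W^{ss}_\epsilon(v)=\{u: d(\phi^tv,\phi^tu)\to0 \text{ as } t\to+\infty,\ d(u,v)<\epsilon\},$$ $$W^{su}_\epsilon(v)=\{u: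 d(\phi^{-t}v,\phi^{-t}u)\to0 \text{ as } t\to+\infty,\ d(u,v)<\epsilon\}.$$ Then for all $\epsilon>0$, $n\ge1$ and $v_1,\dots,v_n\in SM$ such that $v_1,\dots,v_{n-1}$ are backward regular and $v_n$ is forward regular, there is $\delta>0$ (depending on $\epsilon$ and the $v_i$ only) such that for all $t_1,\dots,t_n\ge0$ with $d(\phi^{t_i}v_i,v_{i+1})<\delta$ for $1\le i\le n-1$ there is $w\in SM$ that $\epsilon$-shadows the orbit segments $[v_1,t_1],\dots,[v_{n-1},t_{n-1}],[v_n,+\infty]$ in the following sense. Write $T_k=t_1+\dots+t_{k-1}$ (so $T_1=0$). Then: 1. $w\in W^{su}_\epsilon(\phi^{r}v_1)$ for some $|r|<\epsilon$; 2. $\phi^{T_n}w\in W^{ss}_\epsilon(v_n)$, and $d(\phi^{T_n+s}w,\phi^sv_n)<\epsilon$ for all $s\ge0$; 3. there are numbers $t_1',\dots,t_{n-1}'$ with $|t_k'|<\epsilon$ such that $d(\phi^{T_k+s}w,\phi^{t_k'+s}v_k)<\epsilon$ for all $1\le k\le n-1$ and $0\le s\le t_k$. -/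

import Mathlib

open Filter Topology
open scoped LinearAlgebra.Projectivization MatrixGroups

noncomputable section

namespace HilbertGeometry

/-! ### Properly convex domains in real projective space `ℝP³` -/

/-- Homogeneous coordinates on `ℝP³ = ℙ ℝ V`. -/
abbrev V : Type := Fin 4 → ℝ

/-- The trace of `Ω ⊆ ℝP³` in the affine chart `{f ≠ 0}`, which is identified with the affine
hyperplane `{f = 1}` of `ℝ⁴`. -/
def affineTrace (Ω : Set (ℙ ℝ V)) (f : V →ₗ[ℝ] ℝ) : Set V :=
  {x | f x = 1 ∧ ∃ h : x ≠ 0, Projectivization.mk ℝ x h ∈ Ω}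

/-- A properly convex domain `Ω ⊆ ℝP³`, together with an affine chart `{chart ≠ 0}` in which it is
bounded and convex. -/
structure ProperlyConvexDomain where
  /-- the domain -/
  Ω : Set (ℙ ℝ V)
  /-- the linear form whose kernel is the hyperplane at infinity of the chart -/
  chart : V →ₗ[ℝ] ℝ
  /-- `Ω` is open in `ℝP³`, the quotient of `ℝ⁴ \ {0}` -/
  isOpen : IsOpen {x : V | ∃ h : x ≠ 0, Projectivization.mk ℝ x h ∈ Ω}
  nonempty : Ω.Nonempty
  /-- `Ω` lies in the affine chart -/
  subset_chart : ∀ (x : V) (h : x ≠ 0), Projectivization.mk ℝ x h ∈ Ω → chart x ≠ 0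
  convex : Convex ℝ (affineTrace Ω chart)
  bounded : Bornology.IsBounded (affineTrace Ω chart)

namespace ProperlyConvexDomain

variable (D : ProperlyConvexDomain)

/-- The domain as a subset of the affine hyperplane `{chart = 1}`. -/
def carrier : Set V := affineTrace D.Ω D.chart

/-- The boundary `∂Ω`, in the affine chart. -/
def boundary : Set V := closure D.carrier \ D.carrier

/-- `Ω` is strictly convex: a line in the complement of `Ω` meets `∂Ω` in at most one point. -/
def IsStrictlyConvex : Prop :=
  ∀ x ∈ D.boundary, ∀ y ∈ D.boundary,
    (∀ t : ℝ, AffineMap.lineMap x y t ∉ D.carrier) → x = y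

/-- The cone in `ℝ⁴` over `Ω`. -/
def cone : Set V := {x | ∃ t : ℝ, 0 < t ∧ ∃ y ∈ D.carrier, x = t • y}

/-- `C` is a (nonempty) properly convex cone in the subspace `W`: a convex cone whose closure
contains no line. -/
def _root_.HilbertGeometry.IsProperlyConvexCone (W : Submodule ℝ V) (C : Set V) : Prop :=
  C ⊆ W ∧ C.Nonempty ∧ Convex ℝ C ∧ (∀ t : ℝ, 0 < t → ∀ x ∈ C, t • x ∈ C) ∧
    ∀ x, x ∈ closure C → -x ∈ closure C → x = 0

/-- `Ω` is decomposable: the cone over it is a sum of properly convex cones in two nonzero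
complementary subspaces. -/
def IsDecomposable : Prop :=
  ∃ W₁ W₂ : Submodule ℝ V, W₁ ≠ ⊥ ∧ W₂ ≠ ⊥ ∧ IsCompl W₁ W₂ ∧
    ∃ C₁ C₂ : Set V, IsProperlyConvexCone W₁ C₁ ∧ IsProperlyConvexCone W₂ C₂ ∧
      D.cone = {x | ∃ y ∈ C₁, ∃ z ∈ C₂, x = y + z}

/-- A boundary point is proper if there is a unique supporting (projective) hyperplane at it, i.e.
a unique hyperplane that contains it and avoids `Ω`. -/
def IsProperPoint (ξ : V) : Prop :=
  ∃! H : Submodule ℝ V, IsCoatom H ∧ ξ ∈ H ∧ ∀ x ∈ D.carrier, x ∉ H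

/-- A boundary point is extremal if no open line segment contained in `∂Ω` contains it. -/
def IsExtremalPoint (ξ : V) : Prop :=
  ¬ ∃ x y : V, x ≠ y ∧ ξ ∈ openSegment ℝ x y ∧ openSegment ℝ x y ⊆ D.boundary

/-! ### The Finsler unit tangent bundle and the geodesic flow of `Ω` -/

/-- The parameter at which the ray `t ↦ x + t v`, `t ≥ 0`, leaves `Ω`. -/
def exitTime (x v : V) : ℝ := sSup {t : ℝ | x + t • v ∈ D.carrier}

/-- The Finsler norm `F(x,v) = (|v|/2) (1/|x v⁺| + 1/|x v⁻|)` of the Hilbert metric. Here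
`v⁺ = x + exitTime x v • v` and `v⁻ = x - exitTime x (-v) • v`. -/
def finsler (x v : V) : ℝ := (1 / D.exitTime x v + 1 / D.exitTime x (-v)) / 2

/-- The Hilbert metric `d(x,y) = ½ |log ((|ay| / |ax|) (|bx| / |by|))|`, where `b` and `a` are the
points in which the line from `x` to `y` leaves `Ω` in the forward and in the backward direction,
and lengths are measured in units of `|xy|`. -/
def hilbertDist (x y : V) : ℝ :=
  |Real.log (((D.exitTime x (x - y) + 1) / D.exitTime x (x - y)) *
    (D.exitTime x (y - x) / (D.exitTime x (y - x) - 1)))| / 2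

/-- The unit tangent bundle `SΩ`: pairs `(x,v)` of a point `x` of `Ω` and a vector `v` tangent to
the chart `{chart = 1}`, of Finsler norm one. -/
abbrev UnitTangent : Type :=
  {u : V × V // u.1 ∈ D.carrier ∧ D.chart u.2 = 0 ∧ D.finsler u.1 u.2 = 1}

/-- The forward endpoint `v⁺ ∈ ∂Ω` of the projective line through `(x,v)`. -/
def endpointPos (u : V × V) : V := u.1 + D.exitTime u.1 u.2 • u.2

/-- The backward endpoint `v⁻ ∈ ∂Ω` of the projective line through `(x,v)`. -/
def endpointNeg (u : V × V) : V := u.1 - D.exitTime u.1 (-u.2) • u.2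

/-- The parameter `s(t)` such that `t ↦ x + s(t) v` is the projective line `ℓ` through `(x,v)`
parametrized at unit Hilbert speed, in terms of `a = exitTime x v` and `b = exitTime x (-v)`. It is
determined by `[v⁻, x, ℓ(t), v⁺] = exp (2 t)`. -/
def lineParam (a b t : ℝ) : ℝ :=
  a * b * (Real.exp t - Real.exp (-t)) / (b * Real.exp t + a * Real.exp (-t))

/-- The derivative `s'(t)` of `lineParam`. -/
def lineSpeed (a b t : ℝ) : ℝ :=
  2 * (a * b) * (a + b) / (b * Real.exp t + a * Real.exp (-t)) ^ 2

/-- The geodesic flow on tangent vectors, `(x,v) ↦ (ℓ(t), ℓ'(t))` with `ℓ` the projective line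
through `(x,v)`, parametrized at unit Hilbert speed. -/
def flowFun (t : ℝ) (u : V × V) : V × V :=
  (u.1 + lineParam (D.exitTime u.1 u.2) (D.exitTime u.1 (-u.2)) t • u.2,
    lineSpeed (D.exitTime u.1 u.2) (D.exitTime u.1 (-u.2)) t • u.2)


/-! The following facts show that the geodesic flow is well defined. -/

variable {D}

theorem smul_mem_Ω {z : V} {c : ℝ} (hc : c ≠ 0) :
    (∃ h : c • z ≠ 0, Projectivization.mk ℝ (c • z) h ∈ D.Ω) ↔
      ∃ h : z ≠ 0, Projectivization.mk ℝ z h ∈ D.Ω := by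
  have key : ∀ (h : z ≠ 0) (h' : c • z ≠ 0),
      Projectivization.mk ℝ (c • z) h' = Projectivization.mk ℝ z h := by
    intro h h'
    rw [Projectivization.mk_eq_mk_iff']
    exact ⟨c, rfl⟩
  constructor
  · rintro ⟨h, hm⟩
    have hz : z ≠ 0 := by
      rintro rfl
      simp at h
    exact ⟨hz, key hz h ▸ hm⟩
  · rintro ⟨h, hm⟩
    have hz : c • z ≠ 0 := smul_ne_zero hc h
    exact ⟨hz, (key h hz).symm ▸ hm⟩

theorem isOpen_line {x v : V} (hx : x ∈ D.carrier) (hv : D.chart v = 0) :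
    IsOpen {t : ℝ | x + t • v ∈ D.carrier} := by
  have : {t : ℝ | x + t • v ∈ D.carrier} =
      (fun t : ℝ => x + t • v) ⁻¹' {x : V | ∃ h : x ≠ 0, Projectivization.mk ℝ x h ∈ D.Ω} := by
    ext t
    simp only [Set.mem_ofPred_eq, Set.mem_preimage, carrier, affineTrace]
    constructor
    · exact fun h => h.2
    · intro h
      exact ⟨by simp [hv, hx.1], h⟩
  rw [this]
  exact D.isOpen.preimage (by fun_prop)

theorem bddAbove_line {x v : V} (hv0 : v ≠ 0) :
    BddAbove {t : ℝ | x + t • v ∈ D.carrier} := by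
  obtain ⟨R, hR⟩ := D.bounded.exists_norm_le
  refine ⟨(R + ‖x‖) / ‖v‖, fun t ht => ?_⟩
  have hv' : 0 < ‖v‖ := norm_pos_iff.2 hv0
  rw [le_div_iff₀ hv']
  have h1 := hR _ ht
  have h2 : ‖t • v‖ ≤ ‖x + t • v‖ + ‖x‖ := by
    have := norm_sub_le (x + t • v) x
    simpa using this
  rw [norm_smul, Real.norm_eq_abs] at h2
  have h3 : t * ‖v‖ ≤ |t| * ‖v‖ := by
    gcongr
    exact le_abs_self t
  linarith

theorem convex_line {x v : V} {s t : ℝ} (hx : x ∈ D.carrier) (hs : x + s • v ∈ D.carrier)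
    (h0 : 0 ≤ t) (hts : t ≤ s) : x + t • v ∈ D.carrier := by
  rcases h0.eq_or_lt with rfl | h0
  · simpa using hx
  have hs0 : 0 < s := h0.trans_le hts
  have := D.convex hx hs (a := 1 - t / s) (b := t / s)
    (by rw [sub_nonneg, div_le_one hs0]; exact hts) (by positivity) (by ring)
  have e : (1 - t / s) • x + (t / s) • (x + s • v) = x + t • v := by
    rw [smul_add, smul_smul, div_mul_cancel₀ _ hs0.ne']
    module
  rw [e] at this
  exact this

theorem exitTime_pos {x v : V} (hx : x ∈ D.carrier) (hv : D.chart v = 0) (hv0 : v ≠ 0) :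
    0 < D.exitTime x v := by
  obtain ⟨e, he, h⟩ := Metric.isOpen_iff.1 (isOpen_line hx hv) 0 (by simpa using hx)
  have : e / 2 ∈ {t : ℝ | x + t • v ∈ D.carrier} := h (by
    rw [Metric.mem_ball, Real.dist_eq, sub_zero, abs_of_pos (by positivity)]
    linarith)
  have := le_csSup (bddAbove_line hv0) this
  exact lt_of_lt_of_le (by positivity) this

theorem mem_iff_lt_exitTime {x v : V} (hx : x ∈ D.carrier) (hv : D.chart v = 0) (hv0 : v ≠ 0)
    {t : ℝ} (ht : 0 ≤ t) : x + t • v ∈ D.carrier ↔ t < D.exitTime x v := by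
  constructor
  · intro h
    obtain ⟨e, he, h⟩ := Metric.isOpen_iff.1 (isOpen_line hx hv) t h
    have : t + e / 2 ∈ {t : ℝ | x + t • v ∈ D.carrier} := h (by
      rw [Metric.mem_ball, Real.dist_eq, add_sub_cancel_left, abs_of_pos (by positivity)]
      linarith)
    have := le_csSup (bddAbove_line hv0) this
    exact lt_of_lt_of_le (by linarith) this
  · intro h
    obtain ⟨s, hs, hts⟩ := exists_lt_of_lt_csSup ⟨0, by simpa using hx⟩ h
    exact convex_line hx hs ht hts.le

theorem mem_line_iff {x v : V} (hx : x ∈ D.carrier) (hv : D.chart v = 0) (hv0 : v ≠ 0) (t : ℝ) :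
    x + t • v ∈ D.carrier ↔ -D.exitTime x (-v) < t ∧ t < D.exitTime x v := by
  have hA := exitTime_pos hx hv hv0
  have hB := exitTime_pos (v := -v) hx (by simpa using hv) (neg_ne_zero.2 hv0)
  rcases le_total 0 t with ht | ht
  · rw [mem_iff_lt_exitTime hx hv hv0 ht]
    exact ⟨fun h => ⟨by linarith, h⟩, fun h => h.2⟩
  · have := mem_iff_lt_exitTime (v := -v) (t := -t) hx (by simpa using hv) (neg_ne_zero.2 hv0)
      (by linarith)
    rw [neg_smul_neg] at this
    rw [this]
    exact ⟨fun h => ⟨by linarith, by linarith⟩, fun h => by linarith [h.1]⟩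

theorem exitTime_eq {y w : V} {a : ℝ} (ha : 0 < a)
    (h : ∀ t : ℝ, 0 ≤ t → (y + t • w ∈ D.carrier ↔ t < a)) : D.exitTime y w = a := by
  refine IsLUB.csSup_eq ⟨?_, ?_⟩ ⟨0, (h 0 le_rfl).2 ha⟩
  · intro t ht
    rcases le_total 0 t with h0 | h0
    · exact ((h t h0).1 ht).le
    · linarith
  · intro b hb
    refine le_of_forall_lt_imp_le_of_dense fun c hc => ?_
    refine (le_max_left c 0).trans (hb ((h _ (le_max_right c 0)).2 (max_lt hc ha)))

/-- The exit times along a line, seen from another point of it. -/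
theorem exitTime_line {x v : V} (hx : x ∈ D.carrier) (hv : D.chart v = 0) (hv0 : v ≠ 0)
    {s c : ℝ} (hs : x + s • v ∈ D.carrier) (hc : 0 < c) :
    D.exitTime (x + s • v) (c • v) = (D.exitTime x v - s) / c := by
  have hs' := (mem_line_iff hx hv hv0 s).1 hs
  refine exitTime_eq (div_pos (by linarith) hc) fun t ht => ?_
  have : x + s • v + t • c • v = x + (s + t * c) • v := by module
  rw [this, mem_line_iff hx hv hv0, lt_div_iff₀ hc]
  have : 0 ≤ t * c := by positivity
  exact ⟨fun h => by linarith [h.2], fun h => ⟨by linarith, by linarith⟩⟩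

theorem vec_ne_zero {x v : V} (h : D.finsler x v = 1) : v ≠ 0 := by
  rintro rfl
  have : D.exitTime x 0 = 0 := by
    by_cases hx : x ∈ D.carrier <;> simp [exitTime, hx]
  simp [finsler, this] at h

theorem lineParam_mem {a b : ℝ} (ha : 0 < a) (hb : 0 < b) (t : ℝ) :
    a - lineParam a b t = a * (a + b) * Real.exp (-t) / (b * Real.exp t + a * Real.exp (-t)) ∧
    b + lineParam a b t = b * (a + b) * Real.exp t / (b * Real.exp t + a * Real.exp (-t)) := by
  have h1 := Real.exp_pos t
  have h2 := Real.exp_pos (-t)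
  have : 0 < b * Real.exp t + a * Real.exp (-t) := by positivity
  unfold lineParam
  constructor
  · field_simp
    ring
  · field_simp
    ring

theorem flowFun_mem (t : ℝ) {u : V × V}
    (hu : u.1 ∈ D.carrier ∧ D.chart u.2 = 0 ∧ D.finsler u.1 u.2 = 1) :
    (D.flowFun t u).1 ∈ D.carrier ∧ D.chart (D.flowFun t u).2 = 0 ∧
      D.finsler (D.flowFun t u).1 (D.flowFun t u).2 = 1 := by
  obtain ⟨x, v⟩ := u
  obtain ⟨hx, hv, hF⟩ := hu
  have hv0 := vec_ne_zero hF
  have hA := exitTime_pos hx hv hv0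
  have hB := exitTime_pos (v := -v) hx (by simpa using hv) (neg_ne_zero.2 hv0)
  simp only [flowFun]
  dsimp only at hx hv hF
  obtain ⟨h1, h2⟩ := lineParam_mem hA hB t
  set a := D.exitTime x v with ha
  set b := D.exitTime x (-v) with hb
  have e1 := Real.exp_pos t
  have e2 := Real.exp_pos (-t)
  have hD : 0 < b * Real.exp t + a * Real.exp (-t) := by positivity
  have p1 : 0 < a - lineParam a b t := by rw [h1]; positivity
  have p2 : 0 < b + lineParam a b t := by rw [h2]; positivity
  have hsp : 0 < lineSpeed a b t := by unfold lineSpeed; positivity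
  have hmem : x + lineParam a b t • v ∈ D.carrier :=
    (mem_line_iff hx hv hv0 _).2 ⟨by linarith, by linarith⟩
  refine ⟨hmem, by simp [hv], ?_⟩
  have q1 := exitTime_line hx hv hv0 hmem hsp
  have hmem' : x + (-lineParam a b t) • (-v) ∈ D.carrier := by simpa using hmem
  have q2 := exitTime_line (v := -v) hx (by simpa using hv) (neg_ne_zero.2 hv0) hmem' hsp
  rw [neg_smul_neg, smul_neg] at q2
  rw [finsler, q1, q2, ← ha, ← hb, sub_neg_eq_add, h1, h2, lineSpeed]
  have hee : Real.exp t * Real.exp (-t) = 1 := by rw [← Real.exp_add]; simp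
  generalize Real.exp t = X at *
  generalize Real.exp (-t) = Y at *
  field_simp
  linear_combination -hee

variable (D) in
/-- The geodesic flow of `Ω`. -/
def flow (t : ℝ) (u : D.UnitTangent) : D.UnitTangent :=
  ⟨D.flowFun t u.1, flowFun_mem t u.2⟩

/-- The geodesic flow has unit Hilbert speed. -/
theorem hilbertDist_flow (t : ℝ) (u : D.UnitTangent) :
    D.hilbertDist u.1.1 (D.flow t u).1.1 = |t| := by
  obtain ⟨⟨x, v⟩, hx, hv, hF⟩ := u
  dsimp only at hx hv hF
  have hv0 := vec_ne_zero hF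
  have hA := exitTime_pos hx hv hv0
  have hB := exitTime_pos (v := -v) hx (by simpa using hv) (neg_ne_zero.2 hv0)
  obtain ⟨h1, h2⟩ := lineParam_mem hA hB t
  simp only [flow, flowFun, hilbertDist, sub_add_cancel_left, add_sub_cancel_left]
  set a := D.exitTime x v with ha
  set b := D.exitTime x (-v) with hb
  set s := lineParam a b t with hs
  have e1 := Real.exp_pos t
  have e2 := Real.exp_pos (-t)
  have hD : 0 < b * Real.exp t + a * Real.exp (-t) := by positivity
  have p1 : 0 < a - s := by rw [h1]; positivity
  have p2 : 0 < b + s := by rw [h2]; positivity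
  have hexp : (b + s) / b * (a / (a - s)) = Real.exp (2 * t) := by
    rw [h1, h2, show 2 * t = t + t by ring, Real.exp_add]
    have hee : Real.exp t * Real.exp (-t) = 1 := by rw [← Real.exp_add]; simp
    generalize Real.exp t = X at *
    generalize Real.exp (-t) = Y at *
    field_simp
    linear_combination -hee
  have scale : ∀ (w : V) (c : ℝ), D.chart w = 0 → w ≠ 0 → 0 < c →
      D.exitTime x (c • w) = D.exitTime x w / c := by
    intro w c hw hw0 hc
    have := exitTime_line (s := 0) hx hw hw0 (by simpa using hx) hc
    simpa using this
  rcases lt_trichotomy s 0 with h | h | h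
  · have k1 := scale (-v) (-s) (by simpa using hv) (neg_ne_zero.2 hv0) (by linarith)
    have k2 := scale v (-s) hv hv0 (by linarith)
    rw [neg_smul_neg, ← hb] at k1
    rw [neg_smul, ← ha] at k2
    rw [k1, k2]
    have : (a / -s + 1) / (a / -s) * (b / -s / (b / -s - 1)) = Real.exp (-(2 * t)) := by
      rw [Real.exp_neg, ← hexp]
      have : b / -s - 1 = (b + s) / -s := by
        have := h.ne
        field_simp
        ring
      rw [this]
      have := h.ne
      field_simp
      ring
    rw [this, Real.log_exp, abs_neg, abs_mul]
    simp
  · have ht : t = 0 := by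
      rw [h] at hexp
      have : Real.exp (2 * t) = 1 := by
        rw [← hexp, add_zero, sub_zero, div_self hB.ne', div_self hA.ne', one_mul]
      have := Real.exp_eq_one_iff _ |>.1 this
      linarith
    have : D.exitTime x 0 = 0 := by simp [exitTime, hx]
    simp [h, ht, this]
  · have k1 := scale v s hv hv0 h
    have k2 := scale (-v) s (by simpa using hv) (neg_ne_zero.2 hv0) h
    rw [← ha] at k1
    rw [smul_neg, ← hb] at k2
    rw [k1, k2]
    have : (b / s + 1) / (b / s) * (a / s / (a / s - 1)) = Real.exp (2 * t) := by
      rw [← hexp]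
      have : a / s - 1 = (a - s) / s := by
        have := h.ne
        field_simp
      rw [this]
      field_simp
    rw [this, Real.log_exp, abs_mul]
    simp

/-- The derivative of the projective transformation `[A]`, read in the chart `{chart = 1}`. -/
def _root_.HilbertGeometry.projDeriv (f : V →ₗ[ℝ] ℝ) (A : SL(4, ℝ)) (u : V × V) : V × V :=
  ((f (A • u.1))⁻¹ • A • u.1,
    (f (A • u.1))⁻¹ • A • u.2 - (f (A • u.2) / f (A • u.1) ^ 2) • A • u.1)

theorem projDeriv_mul {f : V →ₗ[ℝ] ℝ} {A B : SL(4, ℝ)} {u : V × V} (hA : f (A • u.1) ≠ 0)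
    (hBA : f ((B * A) • u.1) ≠ 0) :
    projDeriv f B (projDeriv f A u) = projDeriv f (B * A) u := by
  obtain ⟨x, v⟩ := u
  simp only [mul_smul] at *
  simp only [projDeriv, mul_smul, smul_sub, smul_comm B _ (_ : V), map_sub, map_smul, smul_eq_mul]
  generalize f (A • x) = l at *
  generalize f (A • v) = m at *
  generalize B • A • x = y at *
  generalize B • A • v = w at *
  generalize f y = p at *
  generalize f w = q at *
  refine Prod.ext ?_ ?_
  · simp only [smul_smul]
    congr 1
    field_simp
  · simp only [smul_smul]
    have h1 : (l⁻¹ * p)⁻¹ * l⁻¹ = p⁻¹ := by field_simp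
    rw [h1, sub_sub, ← add_smul]
    congr 2
    field_simp
    ring

/-- Derivatives of projective transformations act on lines, up to reparametrization. -/
theorem projDeriv_line {f : V →ₗ[ℝ] ℝ} {A : SL(4, ℝ)} {x v : V} (hA : f (A • x) ≠ 0) {t r : ℝ}
    (hr : r = f (A • v) / f (A • x)) (ht : 1 + r * t ≠ 0) :
    (projDeriv f A (x, v)).1 + (t / (1 + r * t)) • (projDeriv f A (x, v)).2 =
      ((1 + r * t) * f (A • x))⁻¹ • (A • (x + t • v)) := by
  subst hr
  simp only [projDeriv, smul_add, smul_comm A _ (_ : V), smul_sub, smul_smul]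
  generalize f (A • x) = l at *
  generalize f (A • v) = m at *
  generalize A • x = y at *
  generalize A • v = w at *
  have hm : m = m / l * l := by field_simp
  generalize m / l = q at *
  subst hm
  generalize hT : 1 + q * t = T at *
  match_scalars
  · field_simp
    linear_combination -hT
  · field_simp

variable (D) in
/-- `[A]` is an automorphism of `Ω`. -/
def IsAut (A : SL(4, ℝ)) : Prop :=
  ∀ p : ℙ ℝ V, (A : PSL(4, ℝ)) • p ∈ D.Ω ↔ p ∈ D.Ω

theorem IsAut.mem_iff {A : SL(4, ℝ)} (hA : D.IsAut A) (z : V) :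
    (∃ h : A • z ≠ 0, Projectivization.mk ℝ (A • z) h ∈ D.Ω) ↔
      ∃ h : z ≠ 0, Projectivization.mk ℝ z h ∈ D.Ω := by
  constructor
  · rintro ⟨h, hm⟩
    have hz : z ≠ 0 := (smul_ne_zero_iff_ne A).1 h
    exact ⟨hz, (hA _).1 hm⟩
  · rintro ⟨h, hm⟩
    exact ⟨(smul_ne_zero_iff_ne A).2 h, (hA _).2 hm⟩

theorem IsAut.chart_ne {A : SL(4, ℝ)} (hA : D.IsAut A) {x : V} (hx : x ∈ D.carrier) :
    D.chart (A • x) ≠ 0 := by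
  obtain ⟨h, hm⟩ := (hA.mem_iff x).2 hx.2
  exact D.subset_chart _ h hm

/-- Exit times in the image of a line under an automorphism. -/
theorem IsAut.exitTime_projDeriv {A : SL(4, ℝ)} (hA : D.IsAut A) {x v : V} (hx : x ∈ D.carrier)
    (hv : D.chart v = 0) (hv0 : v ≠ 0) {r : ℝ} (hr : r = D.chart (A • v) / D.chart (A • x)) :
    0 < 1 + r * D.exitTime x v ∧
      D.exitTime (projDeriv D.chart A (x, v)).1 (projDeriv D.chart A (x, v)).2 =
        D.exitTime x v / (1 + r * D.exitTime x v) := by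
  have hl := hA.chart_ne hx
  have ha := exitTime_pos hx hv hv0
  have hch : ∀ t : ℝ, D.chart (A • (x + t • v)) = (1 + r * t) * D.chart (A • x) := by
    intro t
    rw [smul_add, smul_comm A t v, map_add, LinearMap.map_smul, hr, smul_eq_mul]
    field_simp
  -- membership along the image line
  have hmem : ∀ t : ℝ, 1 + r * t ≠ 0 →
      ((projDeriv D.chart A (x, v)).1 + (t / (1 + r * t)) • (projDeriv D.chart A (x, v)).2 ∈
        D.carrier ↔ x + t • v ∈ D.carrier) := by
    intro t ht
    rw [projDeriv_line hl hr ht]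
    have hne : (1 + r * t) * D.chart (A • x) ≠ 0 := mul_ne_zero ht hl
    have h1 : D.chart (x + t • v) = 1 := by simp [hv, hx.1]
    have h2 : D.chart (((1 + r * t) * D.chart (A • x))⁻¹ • A • (x + t • v)) = 1 := by
      rw [LinearMap.map_smul, hch, smul_eq_mul, inv_mul_cancel₀ hne]
    have h3 := (smul_mem_Ω (D := D) (z := A • (x + t • v)) (inv_ne_zero hne)).trans
      (hA.mem_iff (x + t • v))
    exact ⟨fun h => ⟨h1, h3.1 h.2⟩, fun h => ⟨h2, h3.2 h.2⟩⟩
  have hpos : ∀ t : ℝ, 0 ≤ t → t < D.exitTime x v → 0 < 1 + r * t := by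
    intro t h0 ht
    by_contra hcon
    have hr0 : r < 0 := by
      by_contra h
      have : 0 ≤ r * t := mul_nonneg (not_lt.1 h) h0
      linarith
    have hroot : -1 / r ≤ t := by
      rw [div_le_iff_of_neg hr0]
      linarith
    have h4 : 0 ≤ -1 / r := div_nonneg_of_nonpos (by norm_num) hr0.le
    have h5 : x + (-1 / r) • v ∈ D.carrier :=
      (mem_iff_lt_exitTime hx hv hv0 h4).2 (hroot.trans_lt ht)
    obtain ⟨h, hm⟩ := (hA.mem_iff _).2 h5.2
    refine D.subset_chart _ h hm ?_
    rw [hch]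
    have := hr0.ne
    field_simp
    ring
  set y := (projDeriv D.chart A (x, v)).1 with hy
  set w := (projDeriv D.chart A (x, v)).2 with hw
  have hyU : y ∈ D.carrier := by
    have := (hmem 0 (by simp)).2 (by simpa using hx)
    simpa using this
  have hyc : y = (D.chart (A • x))⁻¹ • A • x := rfl
  have hwc : w = (D.chart (A • x))⁻¹ • A • v -
    (D.chart (A • v) / D.chart (A • x) ^ 2) • A • x := rfl
  have hwch : D.chart w = 0 := by
    rw [hwc, map_sub, LinearMap.map_smul, LinearMap.map_smul, smul_eq_mul, smul_eq_mul]
    field_simp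
    ring
  have hw0 : w ≠ 0 := by
    intro h
    rw [h] at hwc
    have h1 : A • (v - r • x) = 0 := by
      rw [smul_sub, smul_comm A r x, hr]
      have := congrArg (fun z => D.chart (A • x) • z) hwc.symm
      simp only [smul_sub, smul_zero, smul_smul, mul_inv_cancel₀ hl, one_smul] at this
      rw [← this]
      congr 2
      field_simp
    have h2 : v - r • x = 0 := by
      by_contra h
      exact (smul_ne_zero_iff_ne A).2 h h1
    have h3 : v = r • x := sub_eq_zero.1 h2
    have h4 : r = 0 := by
      have := congrArg D.chart h3
      rw [hv, LinearMap.map_smul, hx.1, smul_eq_mul, mul_one] at this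
      exact this.symm
    rw [h4, zero_smul] at h3
    exact hv0 h3
  set a := D.exitTime x v with hadef
  -- the forward endpoint is not sent to infinity
  have hend : 0 < 1 + r * a := by
    have hge : 0 ≤ 1 + r * a := by
      by_contra hcon
      have hr0 : r < 0 := by
        by_contra h
        have : 0 ≤ r * a := mul_nonneg (not_lt.1 h) ha.le
        linarith
      have h4 : 0 ≤ -1 / r := div_nonneg_of_nonpos (by norm_num) hr0.le
      have h5 : -1 / r < a := by
        rw [div_lt_iff_of_neg hr0]
        linarith
      have := hpos _ h4 h5
      rw [mul_div_cancel₀ _ hr0.ne] at this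
      linarith
    refine lt_of_le_of_ne hge fun h => ?_
    have hra : r = -1 / a := by
      field_simp
      linarith
    obtain ⟨R, hR⟩ := bddAbove_line (D := D) (x := y) hw0
    have hall : ∀ s : ℝ, 0 ≤ s → y + s • w ∈ D.carrier := by
      intro s hs
      have hsa : 0 < a + s := by linarith
      have e1 : 1 + r * (s * a / (a + s)) = a / (a + s) := by
        rw [hra]
        field_simp
        ring
      have e2 : s * a / (a + s) / (1 + r * (s * a / (a + s))) = s := by
        rw [e1]
        field_simp
      have e3 : s * a / (a + s) < a := by
        rw [div_lt_iff₀ hsa]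
        nlinarith
      have := (hmem (s * a / (a + s)) (by rw [e1]; positivity)).2
        ((mem_iff_lt_exitTime hx hv hv0 (by positivity)).2 e3)
      rwa [e2] at this
    have h6 := hR (hall (max R 0 + 1) (by positivity))
    have h7 := le_max_left R 0
    linarith
  refine ⟨hend, exitTime_eq (by positivity) fun s hs => ?_⟩
  have hnot : ¬ y + (a / (1 + r * a)) • w ∈ D.carrier := by
    rw [hmem a hend.ne', mem_iff_lt_exitTime hx hv hv0 ha.le]
    exact lt_irrefl a
  constructor
  · intro h
    by_contra hcon
    exact hnot (convex_line hyU h (by positivity) (not_lt.1 hcon))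
  · intro h
    rw [lt_div_iff₀ hend] at h
    have hrs : 0 < 1 - r * s := by
      rcases le_total r 0 with h0 | h0
      · nlinarith [mul_nonneg (neg_nonneg.2 h0) hs]
      · by_contra hcon
        have h8 : (1 - r * s) * a ≤ 0 := mul_nonpos_of_nonpos_of_nonneg (not_lt.1 hcon) ha.le
        nlinarith
    have e1 : 1 + r * (s / (1 - r * s)) = 1 / (1 - r * s) := by
      field_simp
      ring
    have e2 : s / (1 - r * s) / (1 + r * (s / (1 - r * s))) = s := by
      rw [e1, div_div_div_cancel_right₀ hrs.ne', div_one]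
    have e3 : s / (1 - r * s) < a := by
      rw [div_lt_iff₀ hrs]
      nlinarith
    have := (hmem (s / (1 - r * s)) (by rw [e1]; positivity)).2
      ((mem_iff_lt_exitTime hx hv hv0 (by positivity)).2 e3)
    rwa [e2] at this

/-- Automorphisms commute with the geodesic flow. -/
theorem IsAut.flowFun_projDeriv {A : SL(4, ℝ)} (hA : D.IsAut A) (t : ℝ) (u : D.UnitTangent) :
    D.flowFun t (projDeriv D.chart A u.1) = projDeriv D.chart A (D.flowFun t u.1) := by
  obtain ⟨⟨x, v⟩, hx, hv, hF⟩ := u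
  dsimp only at hx hv hF
  have hv0 := vec_ne_zero hF
  have hl := hA.chart_ne hx
  obtain ⟨r, hr⟩ : ∃ r, r = D.chart (A • v) / D.chart (A • x) := ⟨_, rfl⟩
  have hr' : -r = D.chart (A • (-v)) / D.chart (A • x) := by
    rw [hr, smul_neg, map_neg, neg_div]
  have ha := exitTime_pos hx hv hv0
  have hb := exitTime_pos (v := -v) hx (by simpa using hv) (neg_ne_zero.2 hv0)
  obtain ⟨pa, ea⟩ := hA.exitTime_projDeriv hx hv hv0 hr
  obtain ⟨pb, eb⟩ := hA.exitTime_projDeriv (v := -v) hx (by simpa using hv) (neg_ne_zero.2 hv0) hr'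
  have hneg1 : (projDeriv D.chart A (x, -v)).1 = (projDeriv D.chart A (x, v)).1 := rfl
  have hneg2 : (projDeriv D.chart A (x, -v)).2 = -(projDeriv D.chart A (x, v)).2 := by
    simp only [projDeriv, smul_neg, map_neg, neg_div, neg_smul]
    abel
  rw [hneg1, hneg2] at eb
  have hmem := (flowFun_mem (D := D) t (u := (x, v)) ⟨hx, hv, hF⟩).1
  simp only [flowFun] at hmem ⊢
  rw [ea, eb]
  set a := D.exitTime x v with hadef
  set b := D.exitTime x (-v) with hbdef
  obtain ⟨h1, h2⟩ := lineParam_mem ha hb t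
  have e1 := Real.exp_pos t
  have e2 := Real.exp_pos (-t)
  have hD : 0 < b * Real.exp t + a * Real.exp (-t) := by positivity
  set s := lineParam a b t with hs
  have hch : D.chart (A • (x + s • v)) = (1 + r * s) * D.chart (A • x) := by
    rw [smul_add, smul_comm A s v, map_add, LinearMap.map_smul, hr, smul_eq_mul]
    field_simp
  have hne : 1 + r * s ≠ 0 := by
    intro h
    apply hA.chart_ne hmem
    rw [hch, h, zero_mul]
  have hnum : (1 + r * s) * (b * Real.exp t + a * Real.exp (-t)) =
      b * (1 + r * a) * Real.exp t + a * (1 + -r * b) * Real.exp (-t) := by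
    rw [hs, lineParam]
    field_simp
    ring
  set X := Real.exp t
  set Y := Real.exp (-t)
  set P := 1 + r * a
  set R := 1 + -r * b
  set T := 1 + r * s
  set Q := b * X + a * Y
  have hQT : T * Q = b * P * X + a * R * Y := hnum
  have hden : b / R * X + a / P * Y = T * Q / (P * R) := by
    rw [hQT]
    field_simp
  have hsQ : s * Q = a * b * (X - Y) := by
    rw [hs, lineParam]
    exact div_mul_cancel₀ _ hD.ne'
  have hPR : a * R + b * P = a + b := by
    simp only [P, R]
    ring
  have hparam : lineParam (a / P) (b / R) t = s / T := by
    change a / P * (b / R) * (X - Y) / (b / R * X + a / P * Y) = s / T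
    rw [hden]
    field_simp
    linear_combination -hsQ
  have hspeed : lineSpeed (a / P) (b / R) t = lineSpeed a b t / T ^ 2 := by
    change 2 * (a / P * (b / R)) * (a / P + b / R) / (b / R * X + a / P * Y) ^ 2 =
      2 * (a * b) * (a + b) / Q ^ 2 / T ^ 2
    have h3 : a / P + b / R = (a + b) / (P * R) := by
      rw [← hPR]
      field_simp
    rw [hden, h3]
    field_simp
  rw [hparam, hspeed]
  refine Prod.ext ?_ ?_
  · dsimp only
    rw [projDeriv_line hl hr hne, ← hch]
    rfl
  · generalize lineSpeed a b t = c
    simp only [projDeriv]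
    rw [hch, smul_comm A c v, LinearMap.map_smul, smul_eq_mul, smul_add, smul_comm A s v]
    have hm : D.chart (A • v) = r * D.chart (A • x) := by
      rw [hr, div_mul_cancel₀ _ hl]
    rw [hm]
    have hT : 1 + r * s = T := rfl
    generalize T = T' at *
    generalize D.chart (A • x) = l at *
    generalize A • x = y at *
    generalize A • v = w at *
    match_scalars
    · field_simp
      linear_combination c * hT
    · field_simp

end ProperlyConvexDomain

/-! ### Benoist 3-manifolds -/

/-- A Benoist 3-manifold `M = Ω/Γ`: a compact quotient of a properly convex, indecomposable, not
strictly convex domain `Ω ⊆ ℝP³` by a discrete torsion-free group `Γ` of projective transformations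
that divides it. -/
structure Benoist3Manifold extends ProperlyConvexDomain where
  /-- the dividing group -/
  Γ : Subgroup PSL(4, ℝ)
  preserves : ∀ γ ∈ Γ, ∀ p : ℙ ℝ V, γ • p ∈ Ω ↔ p ∈ Ω
  discrete : DiscreteTopology Γ
  torsionFree : ∀ γ ∈ Γ, γ ≠ 1 → ¬ IsOfFinOrder γ
  cocompact : ∃ K ⊆ affineTrace Ω chart, IsCompact K ∧
    ∀ p ∈ Ω, ∃ γ ∈ Γ, ∃ x ∈ K, ∃ h : x ≠ 0, p = γ • Projectivization.mk ℝ x h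
  indecomposable : ¬ toProperlyConvexDomain.IsDecomposable
  not_strictlyConvex : ¬ toProperlyConvexDomain.IsStrictlyConvex

namespace Benoist3Manifold

variable (B : Benoist3Manifold)

theorem isAut {A : SL(4, ℝ)} (hA : (A : PSL(4, ℝ)) ∈ B.Γ) : B.IsAut A :=
  B.preserves _ hA

/-- Two unit tangent vectors of `Ω` have the same image in `SM` if the derivative `dγ` of some
`γ ∈ Γ` maps one to the other. -/
def orbitSetoid : Setoid B.UnitTangent where
  r u w := ∃ A : SL(4, ℝ), (A : PSL(4, ℝ)) ∈ B.Γ ∧ w.1 = projDeriv B.chart A u.1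
  iseqv := by
    have hone : ∀ u : B.UnitTangent, projDeriv B.chart 1 u.1 = u.1 := by
      intro u
      simp [projDeriv, u.2.1.1, u.2.2.1]
    refine ⟨fun u => ⟨1, B.Γ.one_mem, (hone u).symm⟩, ?_, ?_⟩
    · rintro u w ⟨A, hA, h⟩
      refine ⟨A⁻¹, B.Γ.inv_mem hA, ?_⟩
      rw [h, ProperlyConvexDomain.projDeriv_mul ((B.isAut hA).chart_ne u.2.1), inv_mul_cancel, hone]
      rw [inv_mul_cancel, one_smul, u.2.1.1]
      exact one_ne_zero
    · rintro u w z ⟨A, hA, h⟩ ⟨A', hA', h'⟩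
      have hmem : ((A' * A : SL(4, ℝ)) : PSL(4, ℝ)) ∈ B.Γ := B.Γ.mul_mem hA' hA
      refine ⟨A' * A, hmem, ?_⟩
      rw [h', h, ProperlyConvexDomain.projDeriv_mul ((B.isAut hA).chart_ne u.2.1) ((B.isAut hmem).chart_ne u.2.1)]

/-- The unit tangent bundle `SM = SΩ/Γ`. -/
def SM : Type := Quotient B.orbitSetoid

/-- `SM` carries the quotient topology. -/
instance topologicalSpaceSM : TopologicalSpace B.SM := inferInstanceAs (TopologicalSpace (Quotient B.orbitSetoid))

/-- The projection `SΩ → SM`. -/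
def proj (u : B.UnitTangent) : B.SM := Quotient.mk B.orbitSetoid u

/-- The geodesic flow `φᵗ` of `M`. -/
def geodesicFlow (t : ℝ) : B.SM → B.SM :=
  Quotient.map (B.flow t) (by
    rintro u w ⟨A, hA, h⟩
    refine ⟨A, hA, ?_⟩
    change B.flowFun t w.1 = projDeriv B.chart A (B.flowFun t u.1)
    rw [h, (B.isAut hA).flowFun_projDeriv])

/-- `v ∈ SM` is forward regular if `v⁺` is a proper extremal point (for a lift of `v` to `SΩ`). -/
def IsForwardRegular (v : B.SM) : Prop :=
  ∃ u : B.UnitTangent, B.proj u = v ∧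
    B.IsProperPoint (B.endpointPos u.1) ∧ B.IsExtremalPoint (B.endpointPos u.1)

/-- `v ∈ SM` is backward regular if `v⁻` is a proper extremal point (for a lift of `v` to `SΩ`). -/
def IsBackwardRegular (v : B.SM) : Prop :=
  ∃ u : B.UnitTangent, B.proj u = v ∧
    B.IsProperPoint (B.endpointNeg u.1) ∧ B.IsExtremalPoint (B.endpointNeg u.1)

end Benoist3Manifold

/-! ### Weak orbit gluing, for a flow `φ` on a set `X` with distance function `d` -/

section Gluing

variable {X : Type*} (φ : ℝ → X → X) (d : X → X → ℝ)

/-- The strong stable set `W^{ss}(v)`. -/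
def strongStable (v : X) : Set X :=
  {u | Tendsto (fun t : ℝ => d (φ t v) (φ t u)) atTop (𝓝 0)}

/-- The strong unstable set `W^{su}(v)`. -/
def strongUnstable (v : X) : Set X :=
  {u | Tendsto (fun t : ℝ => d (φ (-t) v) (φ (-t) u)) atTop (𝓝 0)}

/-- The local strong stable set `W^{ss}_ε(v) = W^{ss}(v) ∩ B(v,ε)`. -/
def localStable (ε : ℝ) (v : X) : Set X := {u | u ∈ strongStable φ d v ∧ d u v < ε}

/-- The local strong unstable set `W^{su}_ε(v) = W^{su}(v) ∩ B(v,ε)`. -/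
def localUnstable (ε : ℝ) (v : X) : Set X := {u | u ∈ strongUnstable φ d v ∧ d u v < ε}

/-- `{(v_i,t_i)}`, `i = 0, …, m`, is a `δ`-pseudo-orbit (of length `m + 1`). -/
def IsPseudoOrbit (δ : ℝ) {m : ℕ} (v : Fin (m + 1) → X) (t : Fin (m + 1) → ℝ) : Prop :=
  (∀ i, 0 ≤ t i) ∧ ∀ i : Fin m, d (φ (t i.castSucc) (v i.castSucc)) (v i.succ) < δ

/-- The time `t_0 + ⋯ + t_{k-1}` at which the `k`-th segment of a pseudo-orbit begins. -/
def startTime {m : ℕ} (t : Fin (m + 1) → ℝ) (k : Fin (m + 1)) : ℝ := ∑ j ∈ Finset.Iio k, t j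

/-- The point `w` `ε`-shadows the orbit segments `[v_0,t_0], …, [v_{m-1},t_{m-1}], [v_m,+∞]`. -/
def Shadows (ε : ℝ) {m : ℕ} (v : Fin (m + 1) → X) (t : Fin (m + 1) → ℝ) (w : X) : Prop :=
  (∃ r : ℝ, |r| < ε ∧ w ∈ localUnstable φ d ε (φ r (v 0))) ∧
  φ (startTime t (Fin.last m)) w ∈ localStable φ d ε (v (Fin.last m)) ∧
  (∀ s : ℝ, 0 ≤ s →
    d (φ (startTime t (Fin.last m) + s) w) (φ s (v (Fin.last m))) < ε) ∧
  ∃ t' : Fin m → ℝ, (∀ k, |t' k| < ε) ∧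
    ∀ k : Fin m, ∀ s ∈ Set.Icc 0 (t k.castSucc),
      d (φ (startTime t k.castSucc + s) w) (φ (t' k + s) (v k.castSucc)) < ε

/-- Weak orbit gluing for the pseudo-orbits `{(v_i,t_i)}` whose points `v_0, …, v_m` satisfy `P`:
here `δ` depends on `ε` and on the `v_i`, but not on the `t_i`. -/
def WeakOrbitGluing (P : ∀ {m : ℕ}, (Fin (m + 1) → X) → Prop) : Prop :=
  ∀ ε : ℝ, 0 < ε → ∀ (m : ℕ) (v : Fin (m + 1) → X), P v →
    ∃ δ : ℝ, 0 < δ ∧ ∀ t : Fin (m + 1) → ℝ, IsPseudoOrbit φ d δ v t → ∃ w, Shadows φ d ε v t w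

end Gluing

end HilbertGeometry

end

noncomputable section

namespace HilbertGeometry

namespace ProperlyConvexDomain

variable {D : ProperlyConvexDomain}

/-! ### The cone over a properly convex domain -/

/-! The work takes place in the open cone `C` over `Ω` in `ℝ⁴`. A unit tangent vector is a pair `(p,
q)` of boundary vectors of `C` with `p + q ∈ C`, up to a common positive factor: `[p]` and `[q]` are
its forward and backward endpoints and `[p + q]` is its base point. The geodesic flow becomes
diagonal, `(p, q) ↦ (eᵗ p, e⁻ᵗ q)` (`IsChord.flow_tangent`), and the deck group acts by linear maps
preserving `C`.

Hilbert proximity is expressed by cone order: `Near r x y` says that `r x - y` and `r y - x` lie in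
`C`. For two vectors with the same `p`, the comparison at time `t` amounts to `(r - 1) e²ᵗ p + (r q
- q') ∈ C` and its mirror image. The coefficient of `p` grows, so proximity is never lost in the
future (`Near.exp_smul`). If `[p]` has a unique supporting hyperplane `ker f`, then `C + ℝp` is the
whole half space `{f > 0}` (`IsProperPoint.isSmooth`). Normalizing `f q = f q'` gives `f (r q - q')
> 0`, so the condition holds for large `t` for every `r > 1`: the orbits are asymptotic
(`IsSmoothForm.eventually_near`). Cocompactness makes the passage from `Near` to the metric `d`
uniform (`exists_near_imp_dist_lt`).

This yields a local product structure (`exists_bracket`). If `x` and `y` are close to `v`, `x` has a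
smooth backward endpoint and `y` a smooth forward endpoint, the chord from `x⁻` to `y⁺`, suitably
synchronized, is forward asymptotic to `y` and backward asymptotic to a small time shift of `x`, and
stays close all the way.

Gluing is then formal (`exists_shadows_of_bracket`): shadow the tail of the pseudo-orbit by some
`w'`, bracket the past of `φ^{t₀} v₀` with the future of `w'`, and flow back by `t₀`. Brackets are
only needed near the given vectors, so `δ` does not depend on the times. -/

theorem continuous_chart : Continuous D.chart := LinearMap.continuous_of_finiteDimensional _

theorem mem_cone_iff {x : V} :
    x ∈ D.cone ↔ 0 < D.chart x ∧ ∃ h : x ≠ 0, Projectivization.mk ℝ x h ∈ D.Ω := by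
  constructor
  · rintro ⟨t, ht, y, hy, rfl⟩
    refine ⟨?_, (smul_mem_Ω ht.ne').2 hy.2⟩
    rw [map_smul, hy.1, smul_eq_mul, mul_one]
    exact ht
  · rintro ⟨hx, h⟩
    refine ⟨D.chart x, hx, (D.chart x)⁻¹ • x, ⟨?_, (smul_mem_Ω (inv_ne_zero hx.ne')).2 h⟩, ?_⟩
    · rw [map_smul, smul_eq_mul, inv_mul_cancel₀ hx.ne']
    · rw [smul_smul, mul_inv_cancel₀ hx.ne', one_smul]

theorem mem_carrier_iff {x : V} : x ∈ D.carrier ↔ x ∈ D.cone ∧ D.chart x = 1 := by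
  rw [mem_cone_iff]
  constructor
  · rintro ⟨h1, h2⟩
    exact ⟨⟨by rw [h1]; exact one_pos, h2⟩, h1⟩
  · rintro ⟨⟨_, h2⟩, h1⟩
    exact ⟨h1, h2⟩

theorem chart_pos {x : V} (hx : x ∈ D.cone) : 0 < D.chart x := (mem_cone_iff.1 hx).1

theorem isOpen_cone : IsOpen D.cone := by
  have : D.cone = {x | 0 < D.chart x} ∩
      {x : V | ∃ h : x ≠ 0, Projectivization.mk ℝ x h ∈ D.Ω} := by
    ext x
    exact mem_cone_iff
  rw [this]
  exact (isOpen_lt continuous_const continuous_chart).inter D.isOpen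

theorem smul_mem_cone {x : V} (hx : x ∈ D.cone) {t : ℝ} (ht : 0 < t) : t • x ∈ D.cone := by
  obtain ⟨s, hs, y, hy, rfl⟩ := hx
  exact ⟨t * s, mul_pos ht hs, y, hy, smul_smul _ _ _⟩

theorem add_mem_cone {x y : V} (hx : x ∈ D.cone) (hy : y ∈ D.cone) : x + y ∈ D.cone := by
  obtain ⟨s, hs, x, hx, rfl⟩ := hx
  obtain ⟨t, ht, y, hy, rfl⟩ := hy
  have hst : 0 < s + t := by positivity
  refine ⟨s + t, hst, (s / (s + t)) • x + (t / (s + t)) • y,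
    D.convex hx hy (by positivity) (by positivity) (by field_simp), ?_⟩
  rw [smul_add, smul_smul, smul_smul, mul_div_cancel₀ _ hst.ne', mul_div_cancel₀ _ hst.ne']

theorem cone_nonempty : D.cone.Nonempty := by
  obtain ⟨p, hp⟩ := D.nonempty
  induction p using Projectivization.ind with
  | h x hx =>
    have h := D.subset_chart x hx hp
    refine ⟨(D.chart x)⁻¹ • x, mem_cone_iff.2 ⟨?_, (smul_mem_Ω (inv_ne_zero h)).2 ⟨hx, hp⟩⟩⟩
    rw [map_smul, smul_eq_mul, inv_mul_cancel₀ h]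
    exact one_pos

theorem smul_mem_closure_cone {x : V} (hx : x ∈ closure D.cone) {t : ℝ} (ht : 0 < t) :
    t • x ∈ closure D.cone :=
  map_mem_closure (continuous_const_smul t) hx fun _ h => smul_mem_cone h ht

/-- Openness of the cone allows `y` to be replaced by a nearby `z` in the cone with `x + y - z`
still in the cone. -/
theorem add_mem_cone_of_mem_closure {x y : V} (hx : x ∈ D.cone) (hy : y ∈ closure D.cone) :
    x + y ∈ D.cone := by
  have ho : IsOpen {z : V | x + y - z ∈ D.cone} := isOpen_cone.preimage (by fun_prop)
  obtain ⟨z, hz, hz'⟩ := mem_closure_iff.1 hy _ ho (by simpa using hx)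
  simpa using add_mem_cone hz hz'

/-- The closed cone over a properly convex domain is controlled by the chart. -/
theorem exists_norm_le_chart (D : ProperlyConvexDomain) :
    ∃ R : ℝ, 0 < R ∧ ∀ x ∈ closure D.cone, ‖x‖ ≤ R * D.chart x := by
  obtain ⟨R, hR0, hR⟩ := D.bounded.exists_pos_norm_le
  refine ⟨R, hR0, fun x hx => ?_⟩
  refine closure_minimal (fun x hx => ?_)
    (isClosed_le continuous_norm (continuous_const.mul continuous_chart)) hx
  obtain ⟨t, ht, y, hy, rfl⟩ := hx
  change ‖t • y‖ ≤ R * D.chart (t • y)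
  have h1 : D.chart y = 1 := hy.1
  rw [norm_smul, map_smul, h1, smul_eq_mul, mul_one, Real.norm_of_nonneg ht.le, mul_comm]
  exact mul_le_mul_of_nonneg_right (hR y hy) ht.le

theorem chart_nonneg {x : V} (hx : x ∈ closure D.cone) : 0 ≤ D.chart x :=
  closure_minimal (fun _ h => (chart_pos h).le) (isClosed_le continuous_const continuous_chart) hx

theorem eq_zero_of_chart {x : V} (hx : x ∈ closure D.cone) (h : D.chart x = 0) : x = 0 := by
  obtain ⟨R, -, hR⟩ := D.exists_norm_le_chart
  have := hR x hx
  rw [h, mul_zero] at this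
  exact norm_le_zero_iff.1 this

theorem mem_frontier_iff {x : V} : x ∈ frontier D.cone ↔ x ∈ closure D.cone ∧ x ∉ D.cone := by
  rw [isOpen_cone.frontier_eq, Set.mem_sdiff]

theorem smul_mem_frontier {x : V} (hx : x ∈ frontier D.cone) {t : ℝ} (ht : 0 < t) :
    t • x ∈ frontier D.cone := by
  rw [mem_frontier_iff] at hx ⊢
  refine ⟨smul_mem_closure_cone hx.1 ht, fun h => hx.2 ?_⟩
  have := smul_mem_cone h (inv_pos.2 ht)
  rwa [smul_smul, inv_mul_cancel₀ ht.ne', one_smul] at this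

/-! ### Unit tangent vectors as pairs of boundary vectors of the cone -/

/-- `(p, q)` represents an oriented chord of `Ω` with a marked point `[p + q]`: the forward
endpoint is `[p]`, the backward endpoint is `[q]`. -/
def IsChord (D : ProperlyConvexDomain) (p q : V) : Prop :=
  p ∈ frontier D.cone ∧ q ∈ frontier D.cone ∧ p + q ∈ D.cone

/-- The image in the chart of the tangent vector at `p + q` in the direction `p - q`. -/
def chordVec (D : ProperlyConvexDomain) (p q : V) : V × V :=
  ((D.chart (p + q))⁻¹ • (p + q),
    (D.chart (p + q))⁻¹ • (p - q) - (D.chart (p - q) / D.chart (p + q) ^ 2) • (p + q))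

theorem IsChord.symm {p q : V} (h : D.IsChord p q) : D.IsChord q p :=
  ⟨h.2.1, h.1, by rw [add_comm]; exact h.2.2⟩

theorem IsChord.chart_left_pos {p q : V} (h : D.IsChord p q) : 0 < D.chart p := by
  have h1 := mem_frontier_iff.1 h.1
  refine lt_of_le_of_ne (chart_nonneg h1.1) fun h0 => ?_
  have := eq_zero_of_chart h1.1 h0.symm
  have h2 := h.2.2
  rw [this, zero_add] at h2
  exact (mem_frontier_iff.1 h.2.1).2 h2

theorem IsChord.chart_right_pos {p q : V} (h : D.IsChord p q) : 0 < D.chart q :=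
  h.symm.chart_left_pos

theorem IsChord.mem_cone {p q : V} (h : D.IsChord p q) {a b : ℝ} (ha : 0 < a) (hb : 0 < b) :
    a • p + b • q ∈ D.cone := by
  have hp := (mem_frontier_iff.1 h.1).1
  have hq := (mem_frontier_iff.1 h.2.1).1
  have hm : 0 < min a b / 2 := by positivity
  have h1 : min a b / 2 < a := by linarith [min_le_left a b]
  have h2 : min a b / 2 < b := by linarith [min_le_right a b]
  have := add_mem_cone_of_mem_closure (add_mem_cone_of_mem_closure (smul_mem_cone h.2.2 hm)
    (smul_mem_closure_cone hp (sub_pos.2 h1))) (smul_mem_closure_cone hq (sub_pos.2 h2))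
  convert this using 1
  module

theorem IsChord.smul {p q : V} (h : D.IsChord p q) {a b : ℝ} (ha : 0 < a) (hb : 0 < b) :
    D.IsChord (a • p) (b • q) :=
  ⟨smul_mem_frontier h.1 ha, smul_mem_frontier h.2.1 hb, h.mem_cone ha hb⟩

/-- If `b ≤ 0`, adding the closed-cone vector `-b • q` would put the boundary vector `a • p` into
the open cone. -/
theorem IsChord.pos_right {p q : V} (h : D.IsChord p q) {a b : ℝ} (ha : 0 < a)
    (hab : a • p + b • q ∈ D.cone) : 0 < b := by
  by_contra hb
  rcases (not_lt.1 hb).eq_or_lt with rfl | hb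
  · rw [zero_smul, add_zero] at hab
    exact (mem_frontier_iff.1 (smul_mem_frontier h.1 ha)).2 hab
  · have := add_mem_cone_of_mem_closure hab
      (smul_mem_closure_cone (mem_frontier_iff.1 h.2.1).1 (neg_pos.2 hb))
    rw [add_assoc, ← add_smul, add_neg_cancel, zero_smul, add_zero] at this
    exact (mem_frontier_iff.1 (smul_mem_frontier h.1 ha)).2 this

theorem chordVec_smul {p q : V} {c : ℝ} (hc : c ≠ 0) :
    D.chordVec (c • p) (c • q) = D.chordVec p q := by
  simp only [chordVec, ← smul_add, ← smul_sub, map_smul, smul_eq_mul, smul_smul]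
  refine Prod.ext ?_ ?_
  · dsimp only
    congr 1
    field_simp
  · dsimp only
    congr 2 <;> field_simp

theorem chordVec_of_chart {p q : V} (h : D.chart p + D.chart q = 1) :
    D.chordVec p q = (p + q, (2 * D.chart q) • p - (2 * D.chart p) • q) := by
  have hp : D.chart p = 1 - D.chart q := by linarith
  simp only [chordVec, map_add, map_sub, hp]
  refine Prod.ext ?_ ?_
  · simp
  · dsimp only
    module

/-- In the basis `p, q` the point at parameter `t` has a positive `p`-coefficient and
`q`-coefficient `1 - 2 t χ(p)`, with `χ` the chart; the line leaves the cone exactly when the latter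
vanishes. -/
theorem IsChord.exitTime_eq {p q : V} (h : D.IsChord p q) (h1 : D.chart p + D.chart q = 1) :
    D.exitTime (p + q) ((2 * D.chart q) • p - (2 * D.chart p) • q) = 1 / (2 * D.chart p) := by
  have hp := h.chart_left_pos
  have hq := h.chart_right_pos
  refine ProperlyConvexDomain.exitTime_eq (by positivity) fun t ht => ?_
  have e : p + q + t • ((2 * D.chart q) • p - (2 * D.chart p) • q) =
      (1 + t * (2 * D.chart q)) • p + (1 - t * (2 * D.chart p)) • q := by module
  rw [mem_carrier_iff, e, lt_div_iff₀ (by positivity)]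
  have h0 : 0 < 1 + t * (2 * D.chart q) := by positivity
  constructor
  · intro hm
    linarith [h.pos_right h0 hm.1]
  · intro hm
    refine ⟨h.mem_cone h0 (by linarith), ?_⟩
    rw [map_add, map_smul, map_smul, smul_eq_mul, smul_eq_mul]
    linear_combination h1

theorem IsChord.exitTime_neg {p q : V} (h : D.IsChord p q) (h1 : D.chart p + D.chart q = 1) :
    D.exitTime (p + q) (-((2 * D.chart q) • p - (2 * D.chart p) • q)) = 1 / (2 * D.chart q) := by
  have := h.symm.exitTime_eq (by rwa [add_comm])
  rwa [add_comm q p, ← neg_sub] at this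

/-- Every chord can be rescaled to have its marked point in the chart. -/
theorem IsChord.exists_normalized {p q : V} (h : D.IsChord p q) :
    ∃ p' q', D.IsChord p' q' ∧ D.chart p' + D.chart q' = 1 ∧
      (∃ c : ℝ, 0 < c ∧ p' = c • p ∧ q' = c • q) := by
  have hp := h.chart_left_pos
  have hq := h.chart_right_pos
  have hc : 0 < (D.chart p + D.chart q)⁻¹ := by positivity
  refine ⟨_, _, h.smul hc hc, ?_, _, hc, rfl, rfl⟩
  rw [map_smul, map_smul, smul_eq_mul, smul_eq_mul]
  field_simp

theorem IsChord.chordVec_mem {p q : V} (h : D.IsChord p q) :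
    (D.chordVec p q).1 ∈ D.carrier ∧ D.chart (D.chordVec p q).2 = 0 ∧
      D.finsler (D.chordVec p q).1 (D.chordVec p q).2 = 1 := by
  obtain ⟨p', q', h', h1, c, hc, rfl, rfl⟩ := h.exists_normalized
  rw [← chordVec_smul hc.ne', chordVec_of_chart h1]
  refine ⟨mem_carrier_iff.2 ⟨h'.2.2, by rw [map_add, h1]⟩, ?_, ?_⟩
  · generalize c • p = p at *
    generalize c • q = q at *
    simp only [map_sub, map_smul, smul_eq_mul]
    ring
  · dsimp only
    rw [finsler, h'.exitTime_eq h1, h'.exitTime_neg h1, one_div_one_div, one_div_one_div]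
    linarith

/-- The unit tangent vector represented by a chord. -/
def IsChord.tangent {p q : V} (h : D.IsChord p q) : D.UnitTangent :=
  ⟨D.chordVec p q, h.chordVec_mem⟩

theorem IsChord.tangent_smul {p q : V} (h : D.IsChord p q) {c : ℝ} (hc : 0 < c) :
    (h.smul hc hc).tangent = h.tangent :=
  Subtype.ext (chordVec_smul hc.ne')

/-- The cross-ratio of `q, p + q, eᵗ p + e⁻ᵗ q, p` is `e²ᵗ`, so unit Hilbert speed is the diagonal
action on the pair. After normalization this is an identity between explicit coefficients. -/
theorem IsChord.flow_tangent {p q : V} (h : D.IsChord p q) (t : ℝ) :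
    D.flow t h.tangent = (h.smul (Real.exp_pos t) (Real.exp_pos (-t))).tangent := by
  apply Subtype.ext
  change D.flowFun t (D.chordVec p q) = D.chordVec (Real.exp t • p) (Real.exp (-t) • q)
  obtain ⟨p', q', h', h1, c, hc, rfl, rfl⟩ := h.exists_normalized
  rw [← chordVec_smul hc.ne', ← chordVec_smul (p := Real.exp t • p) hc.ne', smul_comm c (Real.exp t),
    smul_comm c (Real.exp (-t))]
  generalize c • p = p at *
  generalize c • q = q at *
  have ep := Real.exp_pos t
  have eq := Real.exp_pos (-t)
  have hp := h'.chart_left_pos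
  have hq := h'.chart_right_pos
  have hm : 0 < (D.chart p * Real.exp t + D.chart q * Real.exp (-t))⁻¹ := by positivity
  rw [← chordVec_smul (p := Real.exp t • p) hm.ne', chordVec_of_chart h1, chordVec_of_chart, flowFun]
  · dsimp only
    rw [h'.exitTime_eq h1, h'.exitTime_neg h1, lineParam, lineSpeed]
    simp only [map_smul, smul_eq_mul]
    have hee : Real.exp t * Real.exp (-t) = 1 := by rw [← Real.exp_add]; simp
    have hp1 : D.chart p = 1 - D.chart q := by linarith
    generalize Real.exp t = X at *
    generalize Real.exp (-t) = Y at *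
    generalize D.chart p = α at *
    generalize D.chart q = β at *
    subst hp1
    refine Prod.ext ?_ ?_
    · dsimp only
      match_scalars
      · field_simp
        ring
      · field_simp
        ring
    · dsimp only
      match_scalars
      · field_simp
        linear_combination (-1 : ℝ) * hee
      · field_simp
        linear_combination hee
  · simp only [map_smul, smul_eq_mul]
    field_simp

/-! ### Endpoint vectors of a unit tangent vector -/

/-- The representative of the forward endpoint. -/
def fwd (u : D.UnitTangent) : V :=
  (2⁻¹ : ℝ) • ((D.exitTime u.1.1 u.1.2)⁻¹ • u.1.1 + u.1.2)

/-- The representative of the backward endpoint. -/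
def bwd (u : D.UnitTangent) : V :=
  (2⁻¹ : ℝ) • ((D.exitTime u.1.1 (-u.1.2))⁻¹ • u.1.1 - u.1.2)

theorem exitTime_point_mem_frontier {x v : V} (hx : x ∈ D.carrier) (hv : D.chart v = 0)
    (hv0 : v ≠ 0) : x + D.exitTime x v • v ∈ frontier D.cone := by
  have ha := exitTime_pos hx hv hv0
  rw [mem_frontier_iff]
  constructor
  · have hlim : Tendsto (fun t : ℝ => x + t • v) (𝓝[<] D.exitTime x v)
        (𝓝 (x + D.exitTime x v • v)) :=
      ((continuous_const.add (continuous_id.smul continuous_const)).tendsto _).mono_left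
        nhdsWithin_le_nhds
    refine mem_closure_of_tendsto hlim ?_
    filter_upwards [Ioo_mem_nhdsLT ha] with t ht
    exact (mem_carrier_iff.1 ((mem_iff_lt_exitTime hx hv hv0 ht.1.le).2 ht.2)).1
  · intro h
    refine lt_irrefl _ ((mem_iff_lt_exitTime hx hv hv0 ha.le).1 (mem_carrier_iff.2 ⟨h, ?_⟩))
    simp [hv, hx.1]

theorem fwd_eq (u : D.UnitTangent) :
    D.fwd u = (2 * D.exitTime u.1.1 u.1.2)⁻¹ • D.endpointPos u.1 := by
  have ha := exitTime_pos u.2.1 u.2.2.1 (vec_ne_zero u.2.2.2)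
  rw [fwd, endpointPos]
  match_scalars <;> field_simp

theorem bwd_eq (u : D.UnitTangent) :
    D.bwd u = (2 * D.exitTime u.1.1 (-u.1.2))⁻¹ • D.endpointNeg u.1 := by
  have hb := exitTime_pos (v := -u.1.2) u.2.1 (by simpa using u.2.2.1)
    (neg_ne_zero.2 (vec_ne_zero u.2.2.2))
  rw [bwd, endpointNeg]
  match_scalars <;> field_simp

/-- Finsler norm one says that the reciprocals of the two exit times have mean one. -/
theorem fwd_add_bwd (u : D.UnitTangent) : D.fwd u + D.bwd u = u.1.1 := by
  have hF := u.2.2.2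
  rw [finsler, one_div, one_div] at hF
  have : D.fwd u + D.bwd u =
      (((D.exitTime u.1.1 u.1.2)⁻¹ + (D.exitTime u.1.1 (-u.1.2))⁻¹) / 2) • u.1.1 := by
    rw [fwd, bwd]
    module
  rw [this, hF, one_smul]

theorem isChord_fwd_bwd (u : D.UnitTangent) : D.IsChord (D.fwd u) (D.bwd u) := by
  have hv0 := vec_ne_zero u.2.2.2
  have hv' : D.chart (-u.1.2) = 0 := by simpa using u.2.2.1
  have ha := exitTime_pos u.2.1 u.2.2.1 hv0
  have hb := exitTime_pos u.2.1 hv' (neg_ne_zero.2 hv0)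
  refine ⟨?_, ?_, ?_⟩
  · rw [fwd_eq]
    exact smul_mem_frontier (exitTime_point_mem_frontier u.2.1 u.2.2.1 hv0) (by positivity)
  · rw [bwd_eq]
    have := exitTime_point_mem_frontier u.2.1 hv' (neg_ne_zero.2 hv0)
    rw [smul_neg, ← sub_eq_add_neg] at this
    exact smul_mem_frontier this (by positivity)
  · rw [fwd_add_bwd]
    exact (mem_carrier_iff.1 u.2.1).1

theorem tangent_fwd_bwd (u : D.UnitTangent) : (isChord_fwd_bwd u).tangent = u := by
  have hF := u.2.2.2
  rw [finsler, one_div, one_div] at hF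
  have hx : D.chart u.1.1 = 1 := u.2.1.1
  have hf : D.chart (D.fwd u) = (D.exitTime u.1.1 u.1.2)⁻¹ / 2 := by
    rw [fwd, map_smul, map_add, map_smul, hx, u.2.2.1, smul_eq_mul, smul_eq_mul]
    ring
  have hb : D.chart (D.bwd u) = (D.exitTime u.1.1 (-u.1.2))⁻¹ / 2 := by
    rw [bwd, map_smul, map_sub, map_smul, hx, u.2.2.1, smul_eq_mul, smul_eq_mul]
    ring
  apply Subtype.ext
  change D.chordVec _ _ = u.1
  rw [chordVec_of_chart (by rw [hf, hb]; linarith), fwd_add_bwd, hf, hb]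
  refine Prod.ext rfl ?_
  dsimp only
  rw [fwd, bwd]
  generalize (D.exitTime u.1.1 u.1.2)⁻¹ = α at *
  generalize (D.exitTime u.1.1 (-u.1.2))⁻¹ = β at *
  have hα : α = 2 - β := by linarith
  subst hα
  module

theorem IsChord.fwd_bwd_tangent {p q : V} (h : D.IsChord p q) (h1 : D.chart p + D.chart q = 1) :
    D.fwd h.tangent = p ∧ D.bwd h.tangent = q := by
  have hp := h.chart_left_pos
  have hq := h.chart_right_pos
  have hp1 : D.chart p = 1 - D.chart q := by linarith
  have e : h.tangent.1 = (p + q, (2 * D.chart q) • p - (2 * D.chart p) • q) :=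
    chordVec_of_chart h1
  rw [fwd, bwd, e]
  dsimp only
  rw [h.exitTime_eq h1, h.exitTime_neg h1, one_div, inv_inv, one_div, inv_inv, hp1]
  constructor <;> module

theorem IsChord.exists_fwd_bwd_tangent {p q : V} (h : D.IsChord p q) :
    ∃ c : ℝ, 0 < c ∧ D.fwd h.tangent = c • p ∧ D.bwd h.tangent = c • q := by
  obtain ⟨p', q', h', h1, c, hc, rfl, rfl⟩ := h.exists_normalized
  refine ⟨c, hc, ?_⟩
  rw [← h.tangent_smul hc]
  exact h'.fwd_bwd_tangent h1

/-- The exit time depends continuously on the tangent vector. -/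
theorem continuous_exitTime :
    Continuous fun u : {u : V × V // u.1 ∈ D.carrier ∧ D.chart u.2 = 0 ∧ u.2 ≠ 0} =>
      D.exitTime u.1.1 u.1.2 := by
  rw [continuous_iff_continuousAt]
  intro u
  have ha := exitTime_pos u.2.1 u.2.2.1 u.2.2.2
  have hc : ∀ s : ℝ, Continuous
      fun u : {u : V × V // u.1 ∈ D.carrier ∧ D.chart u.2 = 0 ∧ u.2 ≠ 0} =>
        u.1.1 + s • u.1.2 := fun s => by fun_prop
  have hmem : ∀ (s : ℝ) (w : {u : V × V // u.1 ∈ D.carrier ∧ D.chart u.2 = 0 ∧ u.2 ≠ 0}),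
      0 ≤ s → (w.1.1 + s • w.1.2 ∈ D.cone ↔ s < D.exitTime w.1.1 w.1.2) := by
    intro s w hs
    rw [← mem_iff_lt_exitTime w.2.1 w.2.2.1 w.2.2.2 hs, mem_carrier_iff]
    have h1 : D.chart w.1.1 = 1 := w.2.1.1
    simp [h1, w.2.2.1]
  refine tendsto_order.2 ⟨fun s hs => ?_, fun s hs => ?_⟩
  · have hs' : max s 0 < D.exitTime u.1.1 u.1.2 := max_lt hs ha
    have : ∀ᶠ w in 𝓝 u, w.1.1 + max s 0 • w.1.2 ∈ D.cone :=
      (hc (max s 0)).continuousAt.eventually_mem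
        (isOpen_cone.mem_nhds ((hmem _ u (le_max_right _ _)).2 hs'))
    filter_upwards [this] with w hw
    exact (le_max_left _ _).trans_lt ((hmem _ w (le_max_right _ _)).1 hw)
  · obtain ⟨s', h1, h2⟩ := exists_between hs
    have hs0 : 0 < s' := ha.trans h1
    -- If the point at `s' > a` were in the closed cone, the exit point at `a`, a convex combination
    -- of it and the interior base point, would be interior.
    have hnot : u.1.1 + s' • u.1.2 ∉ closure D.cone := by
      intro hcl
      set a := D.exitTime u.1.1 u.1.2
      have hx := (mem_carrier_iff.1 u.2.1).1
      have hpos : 0 < 1 - a / s' := by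
        rw [sub_pos, div_lt_one hs0]
        exact h1
      have := add_mem_cone_of_mem_closure (smul_mem_cone hx hpos)
        (smul_mem_closure_cone hcl (div_pos ha hs0))
      refine lt_irrefl a ((hmem a u ha.le).1 ?_)
      convert this using 1
      match_scalars
      · ring
      · field_simp
    have : ∀ᶠ w in 𝓝 u, w.1.1 + s' • w.1.2 ∈ (closure D.cone)ᶜ :=
      (hc s').continuousAt.eventually_mem (isClosed_closure.isOpen_compl.mem_nhds hnot)
    filter_upwards [this] with w hw
    by_contra hcon
    exact hw (subset_closure ((hmem s' w hs0.le).2 (h2.trans_le (not_lt.1 hcon))))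

theorem continuous_fwd : Continuous (D.fwd) := by
  have h : Continuous fun u : D.UnitTangent => D.exitTime u.1.1 u.1.2 :=
    continuous_exitTime.comp (Continuous.subtype_mk continuous_subtype_val
      fun u => ⟨u.2.1, u.2.2.1, vec_ne_zero u.2.2.2⟩)
  have h0 : ∀ u : D.UnitTangent, D.exitTime u.1.1 u.1.2 ≠ 0 := fun u =>
    (exitTime_pos u.2.1 u.2.2.1 (vec_ne_zero u.2.2.2)).ne'
  have h1 := h.inv₀ h0
  unfold fwd
  fun_prop

theorem continuous_bwd : Continuous (D.bwd) := by
  have h : Continuous fun u : D.UnitTangent => D.exitTime u.1.1 (-u.1.2) :=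
    continuous_exitTime.comp (Continuous.subtype_mk
      (f := fun u : D.UnitTangent => (u.1.1, -u.1.2)) (by fun_prop)
      fun u => ⟨u.2.1, by simpa using u.2.2.1, neg_ne_zero.2 (vec_ne_zero u.2.2.2)⟩)
  have h0 : ∀ u : D.UnitTangent, D.exitTime u.1.1 (-u.1.2) ≠ 0 := fun u =>
    (exitTime_pos u.2.1 (by simpa using u.2.2.1) (neg_ne_zero.2 (vec_ne_zero u.2.2.2))).ne'
  have h1 := h.inv₀ h0
  unfold bwd
  fun_prop

theorem tendsto_chordVec {α : Type*} {l : Filter α} {p q : α → V} {p₀ q₀ : V}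
    (hp : Tendsto p l (𝓝 p₀)) (hq : Tendsto q l (𝓝 q₀)) (h : D.chart (p₀ + q₀) ≠ 0) :
    Tendsto (fun i => D.chordVec (p i) (q i)) l (𝓝 (D.chordVec p₀ q₀)) := by
  have hs := (continuous_chart (D := D)).continuousAt.tendsto.comp (hp.add hq)
  have hd := (continuous_chart (D := D)).continuousAt.tendsto.comp (hp.sub hq)
  exact ((hs.inv₀ h).smul (hp.add hq)).prodMk_nhds
    (((hs.inv₀ h).smul (hp.sub hq)).sub ((hd.div (hs.pow 2) (pow_ne_zero 2 h)).smul (hp.add hq)))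

theorem tendsto_tangent {α : Type*} {l : Filter α} {p q : α → V} {p₀ q₀ : V}
    (hp : Tendsto p l (𝓝 p₀)) (hq : Tendsto q l (𝓝 q₀)) (h : ∀ i, D.IsChord (p i) (q i))
    (h₀ : D.IsChord p₀ q₀) : Tendsto (fun i => (h i).tangent) l (𝓝 h₀.tangent) :=
  tendsto_subtype_rng.2 (tendsto_chordVec hp hq (chart_pos h₀.2.2).ne')

theorem add_smul_mem_cone {x y : V} (hx : x ∈ D.cone) (hy : y ∈ closure D.cone) {c : ℝ}
    (hc : 0 ≤ c) : x + c • y ∈ D.cone := by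
  rcases hc.eq_or_lt with rfl | hc
  · simpa using hx
  · exact add_mem_cone_of_mem_closure hx (smul_mem_closure_cone hy hc)

theorem IsChord.tangent_eq {p q p' q' : V} (h : D.IsChord p q) (h' : D.IsChord p' q') {c : ℝ}
    (hc : 0 < c) (hp : p' = c • p) (hq : q' = c • q) : h'.tangent = h.tangent := by
  subst hp hq
  exact h.tangent_smul hc

/-! ### Smooth points of the boundary of the cone -/

/-- `h` is the differential of the boundary of the cone at `ξ`: the cone, seen from `ξ`, fills up
the half space `{h > 0}`. -/
def IsSmoothForm (D : ProperlyConvexDomain) (h : V →ₗ[ℝ] ℝ) (ξ : V) : Prop :=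
  h ξ = 0 ∧ (∀ x ∈ D.cone, 0 < h x) ∧ ∀ p, 0 < h p → ∃ s : ℝ, s • ξ + p ∈ D.cone

/-- The boundary of the cone is smooth at `ξ`. -/
def IsSmooth (D : ProperlyConvexDomain) (ξ : V) : Prop := ∃ h, D.IsSmoothForm h ξ

theorem IsSmooth.smul {ξ : V} (hξ : D.IsSmooth ξ) {c : ℝ} (hc : c ≠ 0) : D.IsSmooth (c • ξ) := by
  obtain ⟨h, h0, h1, h2⟩ := hξ
  refine ⟨h, by rw [map_smul, h0, smul_zero], h1, fun p hp => ?_⟩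
  obtain ⟨s, hs⟩ := h2 p hp
  exact ⟨s / c, by rwa [smul_smul, div_mul_cancel₀ _ hc]⟩

theorem IsSmooth.map {ξ : V} (hξ : D.IsSmooth ξ) (L : V ≃ₗ[ℝ] V)
    (hL : ∀ x, L x ∈ D.cone ↔ x ∈ D.cone) : D.IsSmooth (L ξ) := by
  obtain ⟨h, h0, h1, h2⟩ := hξ
  refine ⟨h ∘ₗ L.symm.toLinearMap, by simp [h0], fun x hx => ?_, fun p hp => ?_⟩
  · exact h1 _ ((hL _).1 (by simpa using hx))
  · obtain ⟨s, hs⟩ := h2 (L.symm p) hp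
    exact ⟨s, by simpa using (hL _).2 hs⟩

/-- A linear form without zeros in the cone has constant sign. -/
theorem pos_or_neg_of_ne_zero {h : V →ₗ[ℝ] ℝ} (hne : ∀ x ∈ D.cone, h x ≠ 0) :
    (∀ x ∈ D.cone, 0 < h x) ∨ ∀ x ∈ D.cone, h x < 0 := by
  by_contra! hcon
  obtain ⟨⟨x, hx, hx'⟩, y, hy, hy'⟩ := hcon
  have hx' := lt_of_le_of_ne hx' (hne x hx)
  have hy' := lt_of_le_of_ne hy' (hne y hy).symm
  refine hne _ (add_mem_cone (smul_mem_cone hx hy') (smul_mem_cone hy (neg_pos.2 hx'))) ?_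
  simp only [map_add, map_smul, smul_eq_mul]
  ring

theorem isCoatom_ker {h : V →ₗ[ℝ] ℝ} (hh : h ≠ 0) : IsCoatom (LinearMap.ker h) :=
  LinearMap.isCoatom_ker_of_surjective (LinearMap.surjective hh)

/-- A proper point is a smooth point. -/
theorem IsProperPoint.isSmooth {ξ : V} (hξ : D.IsProperPoint ξ) : D.IsSmooth ξ := by
  obtain ⟨H, ⟨hco, hξH, hH⟩, huniq⟩ := hξ
  obtain ⟨x₀, hx₀⟩ := D.cone_nonempty
  have hker : ∃ h : V →ₗ[ℝ] ℝ, LinearMap.ker h = H ∧ ∀ x ∈ D.cone, 0 < h x := by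
    obtain ⟨f, hf, hle⟩ := Submodule.exists_le_ker_of_lt_top H hco.lt_top
    have hfH : LinearMap.ker f = H :=
      (hco.le_iff.1 hle).resolve_left (isCoatom_ker hf).1
    have hne : ∀ x ∈ D.cone, f x ≠ 0 := by
      rintro _ ⟨t, ht, y, hy, rfl⟩ h0
      rw [map_smul, smul_eq_mul] at h0
      have : y ∈ LinearMap.ker f := (mul_eq_zero.1 h0).resolve_left ht.ne'
      rw [hfH] at this
      exact hH y hy this
    rcases pos_or_neg_of_ne_zero hne with h | h
    · exact ⟨f, hfH, h⟩
    · refine ⟨-f, ?_, fun x hx => by simpa using h x hx⟩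
      rw [← hfH]
      ext x
      simp
  obtain ⟨h, hhH, hpos⟩ := hker
  have h0 : h ξ = 0 := by
    rw [← hhH] at hξH
    exact hξH
  refine ⟨h, h0, hpos, fun p hp => ?_⟩
  by_contra hcon
  -- `T = C + ℝξ` is an open convex cone. If it misses `p`, a separating form gives a second
  -- supporting hyperplane at `ξ`, which uniqueness identifies with `ker h`; the signs on `C` and at
  -- `p` then clash.
  set T : Set V := {x | ∃ s : ℝ, s • ξ + x ∈ D.cone} with hT
  have hTo : IsOpen T := by
    have : T = ⋃ s : ℝ, (fun x => s • ξ + x) ⁻¹' D.cone := by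
      ext x
      simp [hT]
    rw [this]
    exact isOpen_iUnion fun s => isOpen_cone.preimage (by fun_prop)
  have hTadd : ∀ x ∈ T, ∀ y ∈ T, x + y ∈ T := by
    rintro x ⟨s, hs⟩ y ⟨t, ht⟩
    refine ⟨s + t, ?_⟩
    convert add_mem_cone hs ht using 1
    module
  have hTsmul : ∀ x ∈ T, ∀ t : ℝ, 0 < t → t • x ∈ T := by
    rintro x ⟨s, hs⟩ t ht
    refine ⟨t * s, ?_⟩
    convert smul_mem_cone hs ht using 1
    module
  have hTc : Convex ℝ T := by
    rw [convex_iff_forall_pos]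
    intro x hx y hy a b ha hb _
    exact hTadd _ (hTsmul x hx a ha) _ (hTsmul y hy b hb)
  obtain ⟨f, hf⟩ := geometric_hahn_banach_open_point hTc hTo hcon
  have hCT : ∀ x ∈ D.cone, x ∈ T := fun x hx => ⟨0, by simpa using hx⟩
  have hfx₀ := hf x₀ (hCT x₀ hx₀)
  have hle : ∀ x ∈ T, f x ≤ 0 := by
    intro x hx
    by_contra! hlt
    -- Scaling `x` by this factor makes `f` exceed `f p`, contradicting the separation: a form
    -- bounded above on a cone is nonpositive there.
    have h1 : 0 < |f p| / f x + 1 := by positivity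
    have h2 := hf _ (hTsmul x hx _ h1)
    rw [map_smul, smul_eq_mul, add_mul, div_mul_cancel₀ _ hlt.ne'] at h2
    linarith [le_abs_self (f p)]
  have hfp : 0 ≤ f p := by
    by_contra! hlt
    have h1 : f x₀ < 0 := hfx₀.trans hlt
    have h2 : 0 < f p / f x₀ := div_pos_of_neg_of_neg hlt h1
    have h3 := hf _ (hTsmul x₀ (hCT x₀ hx₀) _ h2)
    rw [map_smul, smul_eq_mul, div_mul_cancel₀ _ h1.ne] at h3
    exact lt_irrefl _ h3
  -- A zero of `f` in the open set `T` could be pushed towards `p - x₀`, where `f` increases.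
  have hneg : ∀ x ∈ T, f x < 0 := by
    intro x hx
    refine lt_of_le_of_ne (hle x hx) fun h00 => ?_
    have hcont : Continuous fun t : ℝ => x + t • (p - x₀) := by fun_prop
    have hev : ∀ᶠ t : ℝ in 𝓝[>] 0, x + t • (p - x₀) ∈ T :=
      (hcont.continuousAt.eventually_mem (hTo.mem_nhds (by simpa using hx))).filter_mono
        nhdsWithin_le_nhds
    obtain ⟨t, ht, ht0⟩ := (hev.and self_mem_nhdsWithin).exists
    have h1 := hle _ ht
    rw [map_add, map_smul, map_sub, h00, zero_add, smul_eq_mul] at h1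
    have : 0 < t * (f p - f x₀) := mul_pos ht0 (sub_pos.2 hfx₀)
    linarith
  have hfξ : f ξ = 0 := by
    -- `T` is invariant under translation by `ℝξ`, so `f` is bounded above on a line parallel to
    -- `ξ`.
    have hall : ∀ t : ℝ, f x₀ + t * f ξ ≤ 0 := by
      intro t
      have : x₀ + t • ξ ∈ T := ⟨-t, by
        convert hx₀ using 1
        module⟩
      simpa using hle _ this
    by_contra hne
    have := hall ((1 - f x₀) / f ξ)
    rw [div_mul_cancel₀ _ hne] at this
    linarith
  have hf0 : (f : V →ₗ[ℝ] ℝ) ≠ 0 := by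
    intro h
    have : f x₀ = 0 := LinearMap.congr_fun h x₀
    exact (hneg x₀ (hCT x₀ hx₀)).ne this
  have hfH : LinearMap.ker (f : V →ₗ[ℝ] ℝ) = H :=
    huniq _ ⟨isCoatom_ker hf0, hfξ,
      fun x hx h => (hneg x (hCT x (mem_carrier_iff.1 hx).1)).ne h⟩
  -- This vector is killed by `h`, hence by `f`; thus `h x₀ * f p = h p * f x₀ < 0`, although `f p ≥
  -- 0`.
  have hmem : h x₀ • p - h p • x₀ ∈ LinearMap.ker (f : V →ₗ[ℝ] ℝ) := by
    rw [hfH, ← hhH, LinearMap.mem_ker, map_sub, map_smul, map_smul, smul_eq_mul, smul_eq_mul]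
    ring
  have heq : f (h x₀ • p - h p • x₀) = 0 := hmem
  rw [map_sub, map_smul, map_smul, smul_eq_mul, smul_eq_mul] at heq
  have h1 := mul_nonneg (hpos x₀ hx₀).le hfp
  have h2 := mul_neg_of_pos_of_neg hp (hneg x₀ (hCT x₀ hx₀))
  linarith

theorem IsSmoothForm.pos {h : V →ₗ[ℝ] ℝ} {p q : V} (hs : D.IsSmoothForm h p)
    (hpq : D.IsChord p q) : 0 < h q := by
  have := hs.2.1 _ hpq.2.2
  rwa [map_add, hs.1, zero_add] at this

/-! ### Projectively invariant proximity -/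

/-- `x` and `y` are close to each other in the order defined by the cone: their Hilbert distance is
at most `log r`. -/
def Near (D : ProperlyConvexDomain) (r : ℝ) (x y : V) : Prop :=
  r • x - y ∈ D.cone ∧ r • y - x ∈ D.cone

theorem Near.smul {r : ℝ} {x y : V} (h : D.Near r x y) {c : ℝ} (hc : 0 < c) :
    D.Near r (c • x) (c • y) := by
  constructor
  · convert smul_mem_cone h.1 hc using 1
    module
  · convert smul_mem_cone h.2 hc using 1
    module

theorem Near.map {r : ℝ} {x y : V} (h : D.Near r x y) (L : V ≃ₗ[ℝ] V)
    (hL : ∀ x, L x ∈ D.cone ↔ x ∈ D.cone) : D.Near r (L x) (L y) := by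
  constructor
  · simpa using (hL _).2 h.1
  · simpa using (hL _).2 h.2

/-- The difference is `e⁻ᵗ` times the vector in the hypothesis, so all dependence on `t` sits in the
coefficient of `p`. -/
theorem exp_smul_sub_mem_cone {p q q' : V} {r t : ℝ}
    (h : ((r - 1) * Real.exp t ^ 2) • p + (r • q - q') ∈ D.cone) :
    r • (Real.exp t • p + Real.exp (-t) • q) - (Real.exp t • p + Real.exp (-t) • q') ∈
      D.cone := by
  have hee : Real.exp t * Real.exp (-t) = 1 := by rw [← Real.exp_add]; simp
  convert smul_mem_cone h (Real.exp_pos (-t)) using 1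
  match_scalars
  · linear_combination -((r - 1) * Real.exp t) * hee
  · ring
  · ring

/-- Geodesics with a common forward endpoint do not diverge. -/
theorem Near.exp_smul {p q q' : V} {r : ℝ} (hr : 1 ≤ r) (hp : p ∈ closure D.cone)
    (h : D.Near r (p + q) (p + q')) {t : ℝ} (ht : 0 ≤ t) :
    D.Near r (Real.exp t • p + Real.exp (-t) • q) (Real.exp t • p + Real.exp (-t) • q') := by
  have h1 : 0 ≤ (r - 1) * (Real.exp t ^ 2 - 1) :=
    mul_nonneg (sub_nonneg.2 hr) (sub_nonneg.2 (one_le_pow₀ (Real.one_le_exp ht)))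
  constructor
  · apply exp_smul_sub_mem_cone
    convert add_smul_mem_cone h.1 hp h1 using 1
    module
  · apply exp_smul_sub_mem_cone
    convert add_smul_mem_cone h.2 hp h1 using 1
    module

/-- Synchronized geodesics with a common smooth forward endpoint are asymptotic. -/
theorem IsSmoothForm.eventually_near {h : V →ₗ[ℝ] ℝ} {p q q' : V} {r : ℝ} (hr : 1 < r)
    (hs : D.IsSmoothForm h p) (hp : p ∈ closure D.cone) (hq : 0 < h q) (hqq : h q = h q') :
    ∀ᶠ t : ℝ in atTop,
      D.Near r (Real.exp t • p + Real.exp (-t) • q) (Real.exp t • p + Real.exp (-t) • q') := by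
  have key : ∀ q q' : V, 0 < h q → h q = h q' → ∀ᶠ t : ℝ in atTop,
      r • (Real.exp t • p + Real.exp (-t) • q) - (Real.exp t • p + Real.exp (-t) • q') ∈
        D.cone := by
    intro q q' hq hqq
    obtain ⟨s, hs'⟩ := hs.2.2 (r • q - q') (by
      rw [map_sub, map_smul, ← hqq, smul_eq_mul]
      nlinarith)
    have hr0 : 0 < r - 1 := sub_pos.2 hr
    -- Once `eᵗ ≥ s / (r - 1)` and `eᵗ ≥ 1`, also `(r - 1) e²ᵗ ≥ s`, and the surplus multiple of `p`
    -- may be added without leaving the cone.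
    filter_upwards [Real.tendsto_exp_atTop.eventually_ge_atTop (s / (r - 1)),
      eventually_ge_atTop 0] with t h1 h2
    apply exp_smul_sub_mem_cone
    rw [div_le_iff₀ hr0] at h1
    have h3 := Real.one_le_exp h2
    have h4 : 0 ≤ (r - 1) * Real.exp t ^ 2 - s := by nlinarith [mul_pos hr0 (Real.exp_pos t)]
    convert add_smul_mem_cone hs' hp h4 using 1
    module
  exact (key q q' hq hqq).and (key q' q (hqq ▸ hq) hqq.symm)

/-! ### Automorphisms acting on the cone -/

/-- Presents `chordVec` as a projective derivative of the identity, so that `projDeriv_mul` supplies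
its equivariance. -/
theorem projDeriv_one (p q : V) : projDeriv D.chart 1 (p + q, p - q) = D.chordVec p q := by
  simp [projDeriv, chordVec]

/-- An automorphism lifts to a linear map that preserves the cone. -/
theorem IsAut.exists_equiv {A : SL(4, ℝ)} (hA : D.IsAut A) :
    ∃ L : V ≃ₗ[ℝ] V, (∃ c : ℝ, c ≠ 0 ∧ ∀ x, L x = c • A • x) ∧ (∀ x, L x ∈ D.cone ↔ x ∈ D.cone) ∧
      ∀ p q, D.IsChord p q →
        D.chordVec (L p) (L q) = projDeriv D.chart A (D.chordVec p q) := by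
  have hne : ∀ x ∈ D.cone, (D.chart ∘ₗ DistribSMul.toLinearMap ℝ V A) x ≠ 0 := by
    intro x hx
    obtain ⟨h, hm⟩ := (hA.mem_iff x).2 (mem_cone_iff.1 hx).2
    exact D.subset_chart _ h hm
  -- `A` is determined up to sign in `PSL(4, ℝ)` and may send the cone to its negative; `c = ±1`
  -- corrects this.
  obtain ⟨c, hc, hpos⟩ : ∃ c : ℝ, c ≠ 0 ∧ ∀ x ∈ D.cone, 0 < D.chart (c • A • x) := by
    rcases pos_or_neg_of_ne_zero hne with h | h
    · exact ⟨1, one_ne_zero, fun x hx => by simpa using h x hx⟩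
    · exact ⟨-1, by norm_num, fun x hx => by simpa using h x hx⟩
  refine ⟨(DistribMulAction.toLinearEquiv ℝ V A).trans (LinearEquiv.smulOfNeZero ℝ V c hc),
    ⟨c, hc, fun x => rfl⟩, fun x => ?_, fun p q hpq => ?_⟩
  · change c • A • x ∈ D.cone ↔ x ∈ D.cone
    have hiff := (smul_mem_Ω (D := D) (z := A • x) hc).trans (hA.mem_iff x)
    constructor
    · intro hx
      have hP := hiff.1 (mem_cone_iff.1 hx).2
      refine mem_cone_iff.2 ⟨?_, hP⟩
      by_contra hcon
      have hne : D.chart x ≠ 0 := D.subset_chart _ hP.1 hP.2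
      have hneg : (-1 : ℝ) • x ∈ D.cone := mem_cone_iff.2
        ⟨by simpa using lt_of_le_of_ne (not_lt.1 hcon) hne, (smul_mem_Ω (by norm_num)).2 hP⟩
      have h1 := hpos _ hneg
      have h2 := chart_pos hx
      rw [smul_comm A, smul_comm c, map_smul, smul_eq_mul] at h1
      linarith
    · intro hx
      exact mem_cone_iff.2 ⟨hpos x hx, hiff.2 (mem_cone_iff.1 hx).2⟩
  · change D.chordVec (c • A • p) (c • A • q) = _
    rw [chordVec_smul hc, ← projDeriv_one p q, ← projDeriv_one, projDeriv_mul, mul_one]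
    · simp only [projDeriv, one_smul, smul_add, smul_sub]
    · rw [one_smul]
      exact (chart_pos hpq.2.2).ne'
    · rw [mul_one]
      exact hne _ hpq.2.2

theorem IsChord.map {p q : V} (h : D.IsChord p q) (L : V ≃ₗ[ℝ] V)
    (hL : ∀ x, L x ∈ D.cone ↔ x ∈ D.cone) : D.IsChord (L p) (L q) := by
  have hf : ∀ x ∈ frontier D.cone, L x ∈ frontier D.cone := by
    intro x hx
    rw [mem_frontier_iff] at hx ⊢
    refine ⟨map_mem_closure ?_ hx.1 fun y hy => (hL y).2 hy, fun hn => hx.2 ((hL x).1 hn)⟩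
    exact LinearMap.continuous_of_finiteDimensional L.toLinearMap
  exact ⟨hf p h.1, hf q h.2.1, by simpa using (hL _).2 h.2.2⟩

end ProperlyConvexDomain

namespace Benoist3Manifold

open ProperlyConvexDomain

variable {B : Benoist3Manifold}

/-! ### The unit tangent bundle of the quotient -/

theorem continuous_proj : Continuous B.proj := continuous_quot_mk

theorem exists_proj_eq (v : B.SM) : ∃ u, B.proj u = v := Quotient.exists_rep v

theorem geodesicFlow_proj (t : ℝ) (u : B.UnitTangent) :
    B.geodesicFlow t (B.proj u) = B.proj (B.flow t u) := rfl

theorem geodesicFlow_add (s t : ℝ) (v : B.SM) :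
    B.geodesicFlow s (B.geodesicFlow t v) = B.geodesicFlow (s + t) v := by
  obtain ⟨u, rfl⟩ := exists_proj_eq v
  rw [← tangent_fwd_bwd u]
  have h := isChord_fwd_bwd u
  simp only [geodesicFlow_proj, h.flow_tangent, IsChord.flow_tangent]
  congr 1
  exact (h.smul (Real.exp_pos (s + t)) (Real.exp_pos (-(s + t)))).tangent_eq _ one_pos
    (by rw [smul_smul, one_smul, ← Real.exp_add])
    (by rw [smul_smul, one_smul, ← Real.exp_add, neg_add])

theorem geodesicFlow_zero (v : B.SM) : B.geodesicFlow 0 v = v := by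
  obtain ⟨u, rfl⟩ := exists_proj_eq v
  rw [← tangent_fwd_bwd u, geodesicFlow_proj, IsChord.flow_tangent]
  congr 1
  exact (isChord_fwd_bwd u).tangent_eq _ one_pos (by simp) (by simp)

theorem continuous_geodesicFlow_time (v : B.SM) : Continuous fun t => B.geodesicFlow t v := by
  obtain ⟨u, rfl⟩ := exists_proj_eq v
  have h := isChord_fwd_bwd u
  have : (fun t => B.geodesicFlow t (B.proj u)) = B.proj ∘ fun t : ℝ =>
      (h.smul (Real.exp_pos t) (Real.exp_pos (-t))).tangent := by
    ext t
    rw [Function.comp_apply, ← h.flow_tangent, tangent_fwd_bwd, geodesicFlow_proj]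
  rw [this]
  refine continuous_proj.comp (continuous_iff_continuousAt.2 fun t => ?_)
  have h1 : Continuous fun t : ℝ => Real.exp t • fwd u := by fun_prop
  have h2 : Continuous fun t : ℝ => Real.exp (-t) • bwd u := by fun_prop
  exact tendsto_tangent (h1.tendsto t) (h2.tendsto t) _ _

/-- The linear maps that induce the deck transformations of `SΩ → SM`. -/
def IsDeck (B : Benoist3Manifold) (L : V ≃ₗ[ℝ] V) : Prop :=
  (∀ x, L x ∈ B.cone ↔ x ∈ B.cone) ∧
    ∀ p q (h : B.IsChord p q) (h' : B.IsChord (L p) (L q)),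
      B.proj h'.tangent = B.proj h.tangent

theorem exists_isDeck {A : SL(4, ℝ)} (hA : (A : PSL(4, ℝ)) ∈ B.Γ) :
    ∃ L : V ≃ₗ[ℝ] V, B.IsDeck L ∧ (∃ c : ℝ, c ≠ 0 ∧ ∀ x, L x = c • A • x) ∧
      ∀ p q, B.IsChord p q → B.chordVec (L p) (L q) = projDeriv B.chart A (B.chordVec p q) := by
  obtain ⟨L, h1, h2, h3⟩ := (B.isAut hA).exists_equiv
  refine ⟨L, ⟨h2, fun p q h h' => ?_⟩, h1, h3⟩
  have hrel : B.orbitSetoid h.tangent h'.tangent := ⟨A, hA, h3 p q h⟩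
  exact (Quotient.sound hrel).symm

/-- Two lifts of the same vector differ by a deck transformation. -/
theorem exists_deck_of_proj_eq {u w : B.UnitTangent} (h : B.proj u = B.proj w) :
    ∃ L : V ≃ₗ[ℝ] V, B.IsDeck L ∧ ∀ h' : B.IsChord (L (fwd u)) (L (bwd u)), h'.tangent = w := by
  obtain ⟨A, hA, hw⟩ := Quotient.exact h
  obtain ⟨L, hL, -, h3⟩ := exists_isDeck hA
  refine ⟨L, hL, fun h' => Subtype.ext ?_⟩
  rw [hw]
  have := h3 _ _ (isChord_fwd_bwd u)
  rwa [show B.chordVec (fwd u) (bwd u) = u.1 from congrArg Subtype.val (tangent_fwd_bwd u)] at this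

/-- Cocompactness lifted to the cone. The lift preserves the cone, so the remaining scalar is
automatically positive. -/
theorem exists_isDeck_mem_compact (B : Benoist3Manifold) :
    ∃ K : Set V, IsCompact K ∧ K ⊆ B.carrier ∧
      ∀ x ∈ B.cone, ∃ L : V ≃ₗ[ℝ] V, B.IsDeck L ∧ ∃ c : ℝ, 0 < c ∧ c • L x ∈ K := by
  obtain ⟨K, hK, hKc, hcov⟩ := B.cocompact
  refine ⟨K, hKc, hK, fun x hx => ?_⟩
  obtain ⟨hx1, hx0, hxΩ⟩ := mem_cone_iff.1 hx
  obtain ⟨γ, hγ, y, hy, hy0, hxy⟩ := hcov _ hxΩ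
  obtain ⟨A, rfl⟩ := QuotientGroup.mk_surjective γ
  have hA : ((A⁻¹ : SL(4, ℝ)) : PSL(4, ℝ)) ∈ B.Γ := B.Γ.inv_mem hγ
  obtain ⟨L, hL, ⟨c, hc, hLA⟩, -⟩ := exists_isDeck hA
  have h1 : Projectivization.mk ℝ x hx0 =
      Projectivization.mk ℝ (A • y) ((smul_ne_zero_iff_ne A).2 hy0) := hxy
  obtain ⟨e, he⟩ := (Projectivization.mk_eq_mk_iff' ℝ _ _ _ _).1 h1
  have he0 : e ≠ 0 := by
    rintro rfl
    exact hx0 (by rw [← he, zero_smul])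
  have hLx : L x = (c * e) • y := by
    rw [hLA, ← he, smul_comm A⁻¹ e, inv_smul_smul, smul_smul]
  have hyc : B.chart y = 1 := (hK hy).1
  have hpos : 0 < c * e := by
    have := chart_pos ((hL.1 x).2 hx)
    rwa [hLx, map_smul, hyc, smul_eq_mul, mul_one] at this
  exact ⟨L, hL, (c * e)⁻¹, inv_pos.2 hpos, by rwa [hLx, inv_smul_smul₀ hpos.ne']⟩

/-! ### The metric on `SM` and uniform control by cone proximity -/

section Metric

variable (d : MetricSpace B.SM)

theorem tendsto_dist {α : Type*} {l : Filter α} {w : α → B.SM} {v : B.SM}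
    (hd : d.toUniformSpace.toTopologicalSpace = B.topologicalSpaceSM)
    (h : Tendsto w l (𝓝 v)) : Tendsto (fun i => d.dist (w i) v) l (𝓝 0) := by
  rw [← hd] at h
  exact tendsto_iff_dist_tendsto_zero.1 h

/-- Vectors near `proj u` lift to vectors near `u`. -/
theorem exists_lift_mem (hd : d.toUniformSpace.toTopologicalSpace = B.topologicalSpaceSM)
    (u : B.UnitTangent) {U : Set B.UnitTangent} (hU : U ∈ 𝓝 u) :
    ∃ δ : ℝ, 0 < δ ∧ ∀ w : B.SM, d.dist w (B.proj u) < δ → ∃ y ∈ U, B.proj y = w := by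
  obtain ⟨O, hOU, hO, huO⟩ := mem_nhds_iff.1 hU
  -- The projection is open: the deck transformation carrying `w` to `z ∈ O` is continuous, so it
  -- carries vectors near `w` into `O`.
  have hopen : IsOpen (B.proj '' O) := by
    change IsOpen (B.proj ⁻¹' (B.proj '' O))
    rw [isOpen_iff_mem_nhds]
    rintro w ⟨z, hz, hzw⟩
    obtain ⟨L, hL, hLw⟩ := exists_deck_of_proj_eq hzw.symm
    have hch : ∀ y : B.UnitTangent, B.IsChord (L (fwd y)) (L (bwd y)) := fun y =>
      (isChord_fwd_bwd y).map L hL.1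
    have hLc : Continuous L := LinearMap.continuous_of_finiteDimensional L.toLinearMap
    have hlim : Tendsto (fun y => (hch y).tangent) (𝓝 w) (𝓝 (hch w).tangent) :=
      tendsto_tangent ((hLc.comp continuous_fwd).tendsto w) ((hLc.comp continuous_bwd).tendsto w)
        _ _
    rw [hLw] at hlim
    filter_upwards [hlim.eventually_mem (hO.mem_nhds hz)] with y hy
    refine ⟨_, hy, ?_⟩
    rw [hL.2 _ _ (isChord_fwd_bwd y), tangent_fwd_bwd]
  have hn : B.proj '' O ∈ 𝓝 (B.proj u) := hopen.mem_nhds ⟨u, huO, rfl⟩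
  rw [← hd] at hn
  obtain ⟨δ, hδ, hb⟩ := Metric.mem_nhds_iff.1 hn
  refine ⟨δ, hδ, fun w hw => ?_⟩
  obtain ⟨y, hy, rfl⟩ := hb hw
  exact ⟨y, hOU hy, rfl⟩

/-- Proximity, shared endpoints and images in `SM` survive deck maps and positive scaling, so the
first base point can be brought into `K`. -/
theorem exists_near_normalized {K : Set V}
    (hK : ∀ x ∈ B.cone, ∃ L : V ≃ₗ[ℝ] V, B.IsDeck L ∧ ∃ c : ℝ, 0 < c ∧ c • L x ∈ K)
    {p q p' q' : V} (h : B.IsChord p q) (h' : B.IsChord p' q') (hpq : p = p' ∨ q = q') {r : ℝ}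
    (hn : B.Near r (p + q) (p' + q')) :
    ∃ z : (V × V) × (V × V), ∃ (hz : B.IsChord z.1.1 z.1.2) (hz' : B.IsChord z.2.1 z.2.2),
      (z.1.1 = z.2.1 ∨ z.1.2 = z.2.2) ∧ B.Near r (z.1.1 + z.1.2) (z.2.1 + z.2.2) ∧
      z.1.1 + z.1.2 ∈ K ∧ B.proj hz.tangent = B.proj h.tangent ∧
      B.proj hz'.tangent = B.proj h'.tangent := by
  obtain ⟨L, hL, c, hc, hcK⟩ := hK _ h.2.2
  have hm := h.map L hL.1
  have hm' := h'.map L hL.1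
  refine ⟨((c • L p, c • L q), (c • L p', c • L q')), hm.smul hc hc, hm'.smul hc hc, ?_, ?_, ?_,
    ?_, ?_⟩
  · rcases hpq with rfl | rfl
    · exact Or.inl rfl
    · exact Or.inr rfl
  · have := (hn.map L hL.1).smul hc
    simpa only [map_add, smul_add] using this
  · simpa only [map_add, smul_add] using hcK
  · rw [hm.tangent_smul hc, hL.2 _ _ h hm]
  · rw [hm'.tangent_smul hc, hL.2 _ _ h' hm']

/-- Chords that share an endpoint and have close marked points give close vectors, uniformly. -/
theorem exists_near_imp_dist_lt (hd : d.toUniformSpace.toTopologicalSpace = B.topologicalSpaceSM)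
    {ε : ℝ} (hε : 0 < ε) :
    ∃ r : ℝ, 1 < r ∧ ∀ p q p' q' (h : B.IsChord p q) (h' : B.IsChord p' q'),
      (p = p' ∨ q = q') → B.Near r (p + q) (p' + q') →
        d.dist (B.proj h.tangent) (B.proj h'.tangent) < ε := by
  obtain ⟨K, hKc, hKsub, hK⟩ := B.exists_isDeck_mem_compact
  by_contra! hcon
  -- Counterexamples for `r = 1 + 1/(n+1)`, normalized into `K`, subconverge; the limits of the two
  -- chords will coincide.
  have hex : ∀ n : ℕ, ∃ z : (V × V) × (V × V),
      ∃ (hz : B.IsChord z.1.1 z.1.2) (hz' : B.IsChord z.2.1 z.2.2),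
      (z.1.1 = z.2.1 ∨ z.1.2 = z.2.2) ∧
      B.Near (1 + 1 / ((n : ℝ) + 1)) (z.1.1 + z.1.2) (z.2.1 + z.2.2) ∧
      z.1.1 + z.1.2 ∈ K ∧ ε ≤ d.dist (B.proj hz.tangent) (B.proj hz'.tangent) := by
    intro n
    have h1 : (0 : ℝ) < 1 / ((n : ℝ) + 1) := Nat.one_div_pos_of_nat
    obtain ⟨p, q, p', q', h, h', hpq, hn, hdist⟩ := hcon (1 + 1 / ((n : ℝ) + 1)) (by linarith)
    obtain ⟨z, hz, hz', e1, e2, e3, e4, e5⟩ := exists_near_normalized hK h h' hpq hn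
    exact ⟨z, hz, hz', e1, e2, e3, by rwa [e4, e5]⟩
  choose z hz hz' hshare hnear hzK hdist using hex
  obtain ⟨R, hR0, hR⟩ := B.exists_norm_le_chart
  -- The first base point has chart value `1` and `r ≤ 2`, so the second has chart value less than
  -- `2`; the chart controls the norm on the closed cone.
  have hbound : ∀ n, z n ∈ Metric.closedBall (0 : (V × V) × (V × V)) (R * 2) := by
    intro n
    have h1 : B.chart (z n).1.1 + B.chart (z n).1.2 = 1 := by
      rw [← map_add]
      exact (hKsub (hzK n)).1
    have h2 := chart_pos (hnear n).1
    rw [map_sub, map_smul, map_add, map_add, h1, smul_eq_mul, mul_one] at h2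
    have h3 : (1 : ℝ) / ((n : ℝ) + 1) ≤ 1 := by
      rw [div_le_one (by positivity)]
      linarith [(Nat.cast_nonneg n : (0 : ℝ) ≤ n)]
    have c1 := (hz n).chart_left_pos
    have c2 := (hz n).chart_right_pos
    have c3 := (hz' n).chart_left_pos
    have c4 := (hz' n).chart_right_pos
    have hb : ∀ x ∈ frontier B.cone, B.chart x ≤ 2 → ‖x‖ ≤ R * 2 := fun x hx h =>
      (hR x (mem_frontier_iff.1 hx).1).trans (mul_le_mul_of_nonneg_left h hR0.le)
    rw [mem_closedBall_zero_iff, Prod.norm_def, Prod.norm_def, Prod.norm_def]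
    exact max_le (max_le (hb _ (hz n).1 (by linarith)) (hb _ (hz n).2.1 (by linarith)))
      (max_le (hb _ (hz' n).1 (by linarith)) (hb _ (hz' n).2.1 (by linarith)))
  obtain ⟨a, -, φ, hφ, hlim⟩ := (isCompact_closedBall _ _).tendsto_subseq hbound
  have l1 : Tendsto (fun n => (z (φ n)).1.1) atTop (𝓝 a.1.1) :=
    (continuous_fst.fst.tendsto a).comp hlim
  have l2 : Tendsto (fun n => (z (φ n)).1.2) atTop (𝓝 a.1.2) :=
    (continuous_fst.snd.tendsto a).comp hlim
  have l3 : Tendsto (fun n => (z (φ n)).2.1) atTop (𝓝 a.2.1) :=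
    (continuous_snd.fst.tendsto a).comp hlim
  have l4 : Tendsto (fun n => (z (φ n)).2.2) atTop (𝓝 a.2.2) :=
    (continuous_snd.snd.tendsto a).comp hlim
  have lr : Tendsto (fun n => 1 + 1 / ((φ n : ℝ) + 1)) atTop (𝓝 1) := by
    have := (tendsto_one_div_add_atTop_nhds_zero_nat (𝕜 := ℝ)).comp hφ.tendsto_atTop
    simpa using this.const_add 1
  have hfr : ∀ {w : ℕ → V} {b : V}, Tendsto w atTop (𝓝 b) → (∀ n, w n ∈ frontier B.cone) →
      b ∈ frontier B.cone := fun hw hmem =>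
    isClosed_frontier.mem_of_tendsto hw (Eventually.of_forall hmem)
  have haK : a.1.1 + a.1.2 ∈ K :=
    hKc.isClosed.mem_of_tendsto (l1.add l2) (Eventually.of_forall fun n => hzK _)
  have ha : B.IsChord a.1.1 a.1.2 := ⟨hfr l1 fun n => (hz _).1, hfr l2 fun n => (hz _).2.1,
    (mem_carrier_iff.1 (hKsub haK)).1⟩
  -- In the limit `r = 1` the difference and its negative both lie in the closed cone, which
  -- contains no line.
  have hsum : a.1.1 + a.1.2 = a.2.1 + a.2.2 := by
    have t1 : (1 : ℝ) • (a.1.1 + a.1.2) - (a.2.1 + a.2.2) ∈ closure B.cone :=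
      mem_closure_of_tendsto ((lr.smul (l1.add l2)).sub (l3.add l4))
        (Eventually.of_forall fun n => (hnear (φ n)).1)
    have t2 : (1 : ℝ) • (a.2.1 + a.2.2) - (a.1.1 + a.1.2) ∈ closure B.cone :=
      mem_closure_of_tendsto ((lr.smul (l3.add l4)).sub (l1.add l2))
        (Eventually.of_forall fun n => (hnear (φ n)).2)
    have n1 := chart_nonneg t1
    have n2 := chart_nonneg t2
    rw [one_smul] at t1 t2 n1 n2
    rw [map_sub] at n1 n2
    exact sub_eq_zero.1 (eq_zero_of_chart t1 (by rw [map_sub]; linarith))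
  have hor : a.1.1 = a.2.1 ∨ a.1.2 = a.2.2 := by
    have hcl : IsClosed {b : (V × V) × (V × V) | b.1.1 = b.2.1 ∨ b.1.2 = b.2.2} :=
      (isClosed_eq (by fun_prop) (by fun_prop)).union (isClosed_eq (by fun_prop) (by fun_prop))
    exact hcl.mem_of_tendsto hlim (Eventually.of_forall fun n => hshare _)
  -- Equal base vectors alone would allow different directions; the shared endpoint excludes this.
  have heq : a.1.1 = a.2.1 ∧ a.1.2 = a.2.2 := by
    rcases hor with h | h
    · rw [h] at hsum
      exact ⟨h, add_left_cancel hsum⟩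
    · rw [h] at hsum
      exact ⟨add_right_cancel hsum, h⟩
  rw [← heq.1] at l3
  rw [← heq.2] at l4
  have d1 := tendsto_dist d hd
    ((continuous_proj.tendsto _).comp (tendsto_tangent l1 l2 (fun n => hz (φ n)) ha))
  have d2 := tendsto_dist d hd
    ((continuous_proj.tendsto _).comp (tendsto_tangent l3 l4 (fun n => hz' (φ n)) ha))
  have d3 := d1.add d2
  rw [add_zero] at d3
  obtain ⟨n, hn⟩ := (d3.eventually_lt_const hε).exists
  have h1 := hdist (φ n)
  have h2 := @dist_triangle_right B.SM d.toPseudoMetricSpace (B.proj (hz (φ n)).tangent)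
    (B.proj (hz' (φ n)).tangent) (B.proj ha.tangent)
  exact absurd (h1.trans h2) (not_le.2 hn)

/-! ### Smooth endpoints of vectors of `SM` -/

/-- `v` has a lift whose forward endpoint is a smooth point. -/
def ForwardSmooth (v : B.SM) : Prop := ∃ u, B.proj u = v ∧ B.IsSmooth (fwd u)

/-- `v` has a lift whose backward endpoint is a smooth point. -/
def BackwardSmooth (v : B.SM) : Prop := ∃ u, B.proj u = v ∧ B.IsSmooth (bwd u)

theorem IsForwardRegular.forwardSmooth {v : B.SM} (h : B.IsForwardRegular v) :
    ForwardSmooth v := by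
  obtain ⟨u, hu, hp, -⟩ := h
  refine ⟨u, hu, ?_⟩
  have ha := exitTime_pos u.2.1 u.2.2.1 (vec_ne_zero u.2.2.2)
  rw [fwd_eq]
  exact hp.isSmooth.smul (inv_ne_zero (by positivity))

theorem IsBackwardRegular.backwardSmooth {v : B.SM} (h : B.IsBackwardRegular v) :
    BackwardSmooth v := by
  obtain ⟨u, hu, hp, -⟩ := h
  refine ⟨u, hu, ?_⟩
  have hb := exitTime_pos u.2.1 (by simpa using u.2.2.1) (neg_ne_zero.2 (vec_ne_zero u.2.2.2))
  rw [bwd_eq]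
  exact hp.isSmooth.smul (inv_ne_zero (by positivity))

/-- Smoothness is invariant under cone automorphisms and scaling, so it does not depend on the lift.
-/
theorem ForwardSmooth.isSmooth_fwd {u : B.UnitTangent} (h : ForwardSmooth (B.proj u)) :
    B.IsSmooth (fwd u) := by
  obtain ⟨w, hw, hs⟩ := h
  obtain ⟨L, hL, hLu⟩ := exists_deck_of_proj_eq hw
  have hm := (isChord_fwd_bwd w).map L hL.1
  obtain ⟨c, hc, h1, -⟩ := hm.exists_fwd_bwd_tangent
  rw [← hLu hm, h1]
  exact (hs.map L hL.1).smul hc.ne'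

theorem BackwardSmooth.isSmooth_bwd {u : B.UnitTangent} (h : BackwardSmooth (B.proj u)) :
    B.IsSmooth (bwd u) := by
  obtain ⟨w, hw, hs⟩ := h
  obtain ⟨L, hL, hLu⟩ := exists_deck_of_proj_eq hw
  have hm := (isChord_fwd_bwd w).map L hL.1
  obtain ⟨c, hc, -, h1⟩ := hm.exists_fwd_bwd_tangent
  rw [← hLu hm, h1]
  exact (hs.map L hL.1).smul hc.ne'

theorem forwardSmooth_tangent {p q : V} (h : B.IsChord p q) (hp : B.IsSmooth p) :
    ForwardSmooth (B.proj h.tangent) := by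
  obtain ⟨c, hc, h1, -⟩ := h.exists_fwd_bwd_tangent
  exact ⟨_, rfl, h1 ▸ hp.smul hc.ne'⟩

theorem backwardSmooth_tangent {p q : V} (h : B.IsChord p q) (hq : B.IsSmooth q) :
    BackwardSmooth (B.proj h.tangent) := by
  obtain ⟨c, hc, -, h1⟩ := h.exists_fwd_bwd_tangent
  exact ⟨_, rfl, h1 ▸ hq.smul hc.ne'⟩

theorem BackwardSmooth.geodesicFlow {v : B.SM} (h : BackwardSmooth v) (t : ℝ) :
    BackwardSmooth (B.geodesicFlow t v) := by
  obtain ⟨u, rfl, hu⟩ := h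
  rw [← tangent_fwd_bwd u, geodesicFlow_proj, IsChord.flow_tangent]
  exact backwardSmooth_tangent _ (hu.smul (Real.exp_pos _).ne')

theorem ForwardSmooth.geodesicFlow {v : B.SM} (h : ForwardSmooth v) (t : ℝ) :
    ForwardSmooth (B.geodesicFlow t v) := by
  obtain ⟨u, rfl, hu⟩ := h
  rw [← tangent_fwd_bwd u, geodesicFlow_proj, IsChord.flow_tangent]
  exact forwardSmooth_tangent _ (hu.smul (Real.exp_pos _).ne')

/-! ### Asymptotic orbits with a common smooth endpoint -/

/-- Control of a pair of vectors on a common strong stable leaf. -/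
theorem dist_flow_of_common_fwd
    (hd : d.toUniformSpace.toTopologicalSpace = B.topologicalSpaceSM) {p q q' : V}
    (h : B.IsChord p q) (h' : B.IsChord p q') {f : V →ₗ[ℝ] ℝ} (hf : B.IsSmoothForm f p)
    (hq : f q = f q') :
    Tendsto (fun t => d.dist (B.geodesicFlow t (B.proj h.tangent))
      (B.geodesicFlow t (B.proj h'.tangent))) atTop (𝓝 0) := by
  refine tendsto_order.2 ⟨fun e he => Eventually.of_forall fun t => he.trans_le dist_nonneg,
    fun e he => ?_⟩
  obtain ⟨r, hr, hn⟩ := exists_near_imp_dist_lt d hd he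
  filter_upwards [hf.eventually_near hr (mem_frontier_iff.1 h.1).1 (hf.pos h) hq] with t ht
  simp only [geodesicFlow_proj, IsChord.flow_tangent]
  exact hn _ _ _ _ _ _ (Or.inl rfl) ht

/-- Reversing time exchanges the roles of `p` and `q`. -/
theorem dist_flow_of_common_bwd
    (hd : d.toUniformSpace.toTopologicalSpace = B.topologicalSpaceSM) {p p' q : V}
    (h : B.IsChord p q) (h' : B.IsChord p' q) {f : V →ₗ[ℝ] ℝ} (hf : B.IsSmoothForm f q)
    (hp : f p = f p') :
    Tendsto (fun t => d.dist (B.geodesicFlow (-t) (B.proj h.tangent))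
      (B.geodesicFlow (-t) (B.proj h'.tangent))) atTop (𝓝 0) := by
  refine tendsto_order.2 ⟨fun e he => Eventually.of_forall fun t => he.trans_le dist_nonneg,
    fun e he => ?_⟩
  obtain ⟨r, hr, hn⟩ := exists_near_imp_dist_lt d hd he
  filter_upwards [hf.eventually_near hr (mem_frontier_iff.1 h.2.1).1 (hf.pos h.symm) hp] with t ht
  simp only [geodesicFlow_proj, IsChord.flow_tangent]
  refine hn _ _ _ _ _ _ (Or.inr rfl) ?_
  rw [neg_neg, add_comm, add_comm (Real.exp (-t) • p')]
  exact ht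

end Metric

end Benoist3Manifold

/-! ### Local product structure -/

namespace ProperlyConvexDomain

variable {D : ProperlyConvexDomain}

theorem eventually_near_of_tendsto {α : Type*} {l : Filter α} {a b : α → V} {x : V} {r : ℝ}
    (hx : x ∈ D.cone) (hr : 1 < r) (ha : Tendsto a l (𝓝 x)) (hb : Tendsto b l (𝓝 x)) :
    ∀ᶠ i in l, D.Near r (a i) (b i) := by
  have hmem : r • x - x ∈ D.cone := by
    have := smul_mem_cone hx (sub_pos.2 hr)
    rwa [sub_smul, one_smul] at this
  exact (((ha.const_smul r).sub hb).eventually_mem (isOpen_cone.mem_nhds hmem)).and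
    (((hb.const_smul r).sub ha).eventually_mem (isOpen_cone.mem_nhds hmem))

/-- A form positive on the cone is monotone for the cone order. This bounds the synchronizing
constants without any continuity of the supporting form in its base point. -/
theorem Near.form_lt {r : ℝ} {x y : V} (h : D.Near r x y) {f : V →ₗ[ℝ] ℝ}
    (hf : ∀ x ∈ D.cone, 0 < f x) : f y < r * f x ∧ f x < r * f y := by
  have h1 := hf _ h.1
  have h2 := hf _ h.2
  rw [map_sub, map_smul, smul_eq_mul] at h1 h2
  exact ⟨by linarith, by linarith⟩

/-- Local product structure for chords near a given one. -/
theorem IsChord.exists_local_product {p₀ q₀ : V} (h₀ : D.IsChord p₀ q₀) {r η : ℝ} (hr : 1 < r)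
    (hη : 0 < η) :
    ∀ᶠ z : (V × V) × (V × V) in 𝓝 ((p₀, q₀), (p₀, q₀)),
      ∀ f g : V →ₗ[ℝ] ℝ, D.IsChord z.1.1 z.1.2 → D.IsChord z.2.1 z.2.2 →
        D.IsSmoothForm f z.2.1 → D.IsSmoothForm g z.1.2 →
        ∃ c t : ℝ, 0 < c ∧ |t| < η ∧ z.2.1 + z.1.2 ∈ D.cone ∧
          f (c • z.1.2) = f z.2.2 ∧ D.Near r (z.2.1 + c • z.1.2) (z.2.1 + z.2.2) ∧
          g (c⁻¹ • z.2.1) = g (Real.exp (2 * t) • z.1.1) ∧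
          D.Near r (c⁻¹ • z.2.1 + z.1.2) (Real.exp (2 * t) • z.1.1 + z.1.2) := by
  -- The factors `c` and `e²ᵗ` are first treated as free parameters near `1`. All conditions are
  -- open and hold at the base configuration; the product filter then separates endpoints from
  -- parameters.
  have hloc : ∀ᶠ z : ((V × V) × (V × V)) × (ℝ × ℝ) in 𝓝 (((p₀, q₀), (p₀, q₀)), (1, 1)),
      D.Near r (z.1.2.1 + z.2.1 • z.1.1.2) (z.1.2.1 + z.1.2.2) ∧
      D.Near r (z.2.1⁻¹ • z.1.2.1 + z.1.1.2) (z.2.2 • z.1.1.1 + z.1.1.2) ∧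
      |Real.log z.2.2 / 2| < η := by
    have key : ∀ a : ((V × V) × (V × V)) × (ℝ × ℝ) → V,
        ContinuousAt a (((p₀, q₀), (p₀, q₀)), (1, 1)) →
        a (((p₀, q₀), (p₀, q₀)), (1, 1)) = p₀ + q₀ →
        Tendsto a (𝓝 (((p₀, q₀), (p₀, q₀)), (1, 1))) (𝓝 (p₀ + q₀)) := fun a ha h => h ▸ ha
    have hinv : ContinuousAt (fun z : ((V × V) × (V × V)) × (ℝ × ℝ) => z.2.1⁻¹)
        (((p₀, q₀), (p₀, q₀)), (1, 1)) :=
      continuousAt_snd.fst.inv₀ one_ne_zero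
    have hlog : ContinuousAt (fun z : ((V × V) × (V × V)) × (ℝ × ℝ) => |Real.log z.2.2 / 2|)
        (((p₀, q₀), (p₀, q₀)), (1, 1)) :=
      ((continuousAt_snd.snd.log one_ne_zero).div_const 2).abs
    refine (eventually_near_of_tendsto h₀.2.2 hr (key _ (by fun_prop) (by simp))
      (key _ (by fun_prop) rfl)).and
      ((eventually_near_of_tendsto h₀.2.2 hr (key _ ?_ (by simp))
        (key _ (by fun_prop) (by simp))).and (hlog.eventually_lt_const (by simpa using hη)))
    exact (hinv.smul (by fun_prop)).add (by fun_prop)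
  rw [nhds_prod_eq] at hloc
  obtain ⟨P, hP, Q, hQ, hPQ⟩ := eventually_prod_iff.1 hloc
  obtain ⟨ρ, hρ, hball⟩ := Metric.eventually_nhds_iff.1 hQ
  -- Both `c` and `m` will lie in `(κ⁻¹, κ)`, so `c` and `m / c` lie in `(κ⁻², κ²)`, hence within
  -- `ρ` of `1`.
  obtain ⟨κ, hκ1, hκρ⟩ : ∃ κ : ℝ, 1 < κ ∧ κ ^ 2 < 1 + ρ := by
    have hc : ContinuousAt (fun x : ℝ => x ^ 2) 1 := by fun_prop
    have h1 : ∀ᶠ x : ℝ in 𝓝[>] 1, x ^ 2 < 1 + ρ :=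
      (hc.eventually_lt_const (by linarith)).filter_mono nhdsWithin_le_nhds
    obtain ⟨κ, h2, h3⟩ := (h1.and self_mem_nhdsWithin).exists
    exact ⟨κ, h3, h2⟩
  have hcl : ∀ x : ℝ, x < κ ^ 2 → 1 < κ ^ 2 * x → |x - 1| < ρ := by
    intro x h1 h2
    rw [abs_lt]
    have h3 : 1 < κ ^ 2 := by nlinarith
    exact ⟨by nlinarith, by linarith⟩
  have l1 : Tendsto (fun z : (V × V) × (V × V) => z.2.1 + z.1.2) (𝓝 ((p₀, q₀), (p₀, q₀)))
      (𝓝 (p₀ + q₀)) := by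
    have : Continuous fun z : (V × V) × (V × V) => z.2.1 + z.1.2 := by fun_prop
    exact this.tendsto ((p₀, q₀), (p₀, q₀))
  have l2 : Tendsto (fun z : (V × V) × (V × V) => z.2.1 + z.2.2) (𝓝 ((p₀, q₀), (p₀, q₀)))
      (𝓝 (p₀ + q₀)) := by
    have : Continuous fun z : (V × V) × (V × V) => z.2.1 + z.2.2 := by fun_prop
    exact this.tendsto ((p₀, q₀), (p₀, q₀))
  have l3 : Tendsto (fun z : (V × V) × (V × V) => z.1.1 + z.1.2) (𝓝 ((p₀, q₀), (p₀, q₀)))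
      (𝓝 (p₀ + q₀)) := by
    have : Continuous fun z : (V × V) × (V × V) => z.1.1 + z.1.2 := by fun_prop
    exact this.tendsto ((p₀, q₀), (p₀, q₀))
  filter_upwards [hP, l1.eventually_mem (isOpen_cone.mem_nhds h₀.2.2),
    eventually_near_of_tendsto h₀.2.2 hκ1 l1 l2, eventually_near_of_tendsto h₀.2.2 hκ1 l1 l3]
    with z hzP hzC hz1 hz2 f g hx hy hf hg
  have hxy : D.IsChord z.2.1 z.1.2 := ⟨hy.1, hx.2.1, hzC⟩
  have f1 := hf.pos hxy
  have f2 := hf.pos hy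
  have g1 := hg.pos hxy.symm
  have g2 := hg.pos hx.symm
  obtain ⟨f3, f4⟩ := hz1.form_lt hf.2.1
  obtain ⟨g3, g4⟩ := hz2.form_lt hg.2.1
  simp only [map_add, hf.1, hg.1, zero_add, add_zero] at f3 f4 g3 g4
  -- `c` synchronizes the new chord with the second one in the future. In the past, `g` forces `e²ᵗ
  -- = m / c`, which dictates the time shift of the first chord.
  obtain ⟨c, hcdef⟩ : ∃ c, c = f z.2.2 / f z.1.2 := ⟨_, rfl⟩
  obtain ⟨m, hmdef⟩ : ∃ m, m = g z.2.1 / g z.1.1 := ⟨_, rfl⟩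
  have hc : 0 < c := by rw [hcdef]; positivity
  have hm : 0 < m := by rw [hmdef]; positivity
  have hκ0 : 0 < κ := one_pos.trans hκ1
  have c1 : c < κ := by rwa [hcdef, div_lt_iff₀ f1]
  have c2 : 1 < κ * c := by rwa [hcdef, ← mul_div_assoc, lt_div_iff₀ f1, one_mul]
  have m1 : m < κ := by rwa [hmdef, div_lt_iff₀ g2]
  have m2 : 1 < κ * m := by rwa [hmdef, ← mul_div_assoc, lt_div_iff₀ g2, one_mul]
  have e0 : 0 < m / c := by positivity
  have hcρ : |c - 1| < ρ := hcl c (by nlinarith) (by nlinarith)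
  have heρ : |m / c - 1| < ρ := by
    refine hcl _ ?_ ?_
    · rw [div_lt_iff₀ hc]
      nlinarith
    · rw [← mul_div_assoc, lt_div_iff₀ hc]
      nlinarith
  have hQz : Q (c, m / c) := hball (by
    rw [Prod.dist_eq]
    exact max_lt hcρ heρ)
  obtain ⟨n1, n2, n3⟩ := hPQ hzP hQz
  have hexp : Real.exp (2 * (Real.log (m / c) / 2)) = m / c := by
    rw [mul_div_cancel₀ _ two_ne_zero, Real.exp_log e0]
  refine ⟨c, Real.log (m / c) / 2, hc, n3, hzC, ?_, n1, ?_, ?_⟩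
  · rw [map_smul, smul_eq_mul, hcdef, div_mul_cancel₀ _ f1.ne']
  · rw [hexp, map_smul, map_smul, smul_eq_mul, smul_eq_mul, hmdef]
    field_simp
  · rw [hexp]
    exact n2

end ProperlyConvexDomain

namespace Benoist3Manifold

open ProperlyConvexDomain

variable {B : Benoist3Manifold}

/-- Local product structure for the geodesic flow. -/
theorem exists_bracket (d : MetricSpace B.SM)
    (hd : d.toUniformSpace.toTopologicalSpace = B.topologicalSpaceSM) (v : B.SM) {η : ℝ}
    (hη : 0 < η) :
    ∃ δ : ℝ, 0 < δ ∧ ∀ x y : B.SM, d.dist x v < δ → d.dist y v < δ →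
      BackwardSmooth x → ForwardSmooth y → ∃ z, ForwardSmooth z ∧
        (∀ s : ℝ, 0 ≤ s → d.dist (B.geodesicFlow s z) (B.geodesicFlow s y) < η) ∧
        Tendsto (fun s : ℝ => d.dist (B.geodesicFlow s y) (B.geodesicFlow s z)) atTop (𝓝 0) ∧
        ∃ r : ℝ, |r| < η ∧
          (∀ s : ℝ, 0 ≤ s →
            d.dist (B.geodesicFlow (-s) z) (B.geodesicFlow (-s) (B.geodesicFlow r x)) < η) ∧
          Tendsto (fun s : ℝ => d.dist (B.geodesicFlow (-s) (B.geodesicFlow r x))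
            (B.geodesicFlow (-s) z)) atTop (𝓝 0) := by
  obtain ⟨u, rfl⟩ := exists_proj_eq v
  obtain ⟨r, hr, hunif⟩ := exists_near_imp_dist_lt d hd hη
  have hloc := (isChord_fwd_bwd u).exists_local_product hr hη
  rw [nhds_prod_eq] at hloc
  obtain ⟨P, hP, P', hP', hPP⟩ := eventually_prod_iff.1 hloc
  have hends : Continuous fun u : B.UnitTangent => (fwd u, bwd u) :=
    continuous_fwd.prodMk continuous_bwd
  have hU : {w : B.UnitTangent | P (fwd w, bwd w) ∧ P' (fwd w, bwd w)} ∈ 𝓝 u :=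
    ((hends.tendsto u).eventually hP).and ((hends.tendsto u).eventually hP')
  obtain ⟨δ, hδ, hlift⟩ := exists_lift_mem d hd u hU
  refine ⟨δ, hδ, fun x y hx hy hxs hys => ?_⟩
  obtain ⟨x, ⟨hxP, -⟩, rfl⟩ := hlift x hx
  obtain ⟨y, ⟨-, hyP⟩, rfl⟩ := hlift y hy
  obtain ⟨f, hf⟩ := hys.isSmooth_fwd
  obtain ⟨g, hg⟩ := hxs.isSmooth_bwd
  have hxc := isChord_fwd_bwd x
  have hyc := isChord_fwd_bwd y
  obtain ⟨c, t, hc, ht, hmem, hfc, hn1, hgc, hn2⟩ := hPP hxP hyP f g hxc hyc hf hg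
  dsimp only at hmem hfc hn1 hgc hn2
  have hxy : B.IsChord (fwd y) (bwd x) := ⟨hyc.1, hxc.2.1, hmem⟩
  have hz : B.IsChord (fwd y) (c • bwd x) := by
    simpa using hxy.smul one_pos hc
  have hz' : B.IsChord (c⁻¹ • fwd y) (bwd x) := by
    simpa using hxy.smul (inv_pos.2 hc) one_pos
  -- Flowing `x` by `t` gives `(eᵗ p, e⁻ᵗ q)`, which is `(e²ᵗ p, q)` up to a common factor.
  have hx' : B.IsChord (Real.exp (2 * t) • fwd x) (bwd x) := by
    simpa using hxc.smul (Real.exp_pos (2 * t)) one_pos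
  -- The same vector in two scalings: `hz` shares its forward representative with `y`, `hz'` its
  -- backward representative with `x`.
  have ez : hz'.tangent = hz.tangent :=
    hz.tangent_eq hz' (inv_pos.2 hc) rfl (by rw [inv_smul_smul₀ hc.ne'])
  have ey : B.proj y = B.proj hyc.tangent := (congrArg B.proj (tangent_fwd_bwd y)).symm
  have ex : B.geodesicFlow t (B.proj x) = B.proj hx'.tangent := by
    rw [show B.proj x = B.proj hxc.tangent from (congrArg B.proj (tangent_fwd_bwd x)).symm,
      geodesicFlow_proj, hxc.flow_tangent]
    congr 1
    refine (IsChord.tangent_eq _ hx' (Real.exp_pos t) ?_ ?_).symm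
    · rw [smul_smul, ← Real.exp_add, two_mul]
    · rw [smul_smul, ← Real.exp_add, add_neg_cancel, Real.exp_zero, one_smul]
  refine ⟨B.proj hz.tangent, forwardSmooth_tangent hz ⟨f, hf⟩, fun s hs => ?_, ?_, t, ht,
    fun s hs => ?_, ?_⟩
  · rw [ey]
    simp only [geodesicFlow_proj, IsChord.flow_tangent]
    exact hunif _ _ _ _ _ _ (Or.inl rfl) (hn1.exp_smul hr.le (mem_frontier_iff.1 hyc.1).1 hs)
  · rw [ey]
    exact dist_flow_of_common_fwd d hd hyc hz hf hfc.symm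
  · rw [ex, ← ez]
    simp only [geodesicFlow_proj, IsChord.flow_tangent]
    refine hunif _ _ _ _ _ _ (Or.inr rfl) ?_
    rw [add_comm, add_comm (Real.exp (-s) • _ • _), neg_neg]
    refine Near.exp_smul hr.le (mem_frontier_iff.1 hxc.2.1).1 ?_ hs
    rwa [add_comm (bwd x), add_comm (bwd x)]
  · rw [ex, ← ez]
    exact dist_flow_of_common_bwd d hd hx' hz' hg hgc.symm

end Benoist3Manifold

/-! ### Gluing from local product structure -/

section Gluing

theorem startTime_zero {m : ℕ} (t : Fin (m + 1) → ℝ) : startTime t 0 = 0 := by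
  have : Finset.Iio (0 : Fin (m + 1)) = ∅ := by
    ext i
    simp
  rw [startTime, this, Finset.sum_empty]

theorem startTime_succ {m : ℕ} (t : Fin (m + 2) → ℝ) (k : Fin (m + 1)) :
    startTime t k.succ = t 0 + startTime (fun i => t i.succ) k := by
  have : Finset.Iio k.succ =
      Finset.cons 0 ((Finset.Iio k).map (Fin.succEmb _)) (by simp) := by
    ext i
    refine Fin.cases ?_ (fun j => ?_) i
    · simp
    · simp
  rw [startTime, this, Finset.sum_cons, Finset.sum_map]
  rfl

/-- A flow with a local product structure has weak orbit gluing. -/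
theorem exists_shadows_of_bracket {X : Type*} (d : MetricSpace X) {φ : ℝ → X → X}
    (hadd : ∀ s t v, φ s (φ t v) = φ (s + t) v) (hzero : ∀ v, φ 0 v = v)
    (hcont : ∀ v, Tendsto (fun t => d.dist (φ t v) v) (𝓝 0) (𝓝 0))
    {P Q : X → Prop} (hP : ∀ v t, P v → P (φ t v)) (hQ : ∀ v t, Q v → Q (φ t v))
    (hbr : ∀ v η, 0 < η → ∃ δ : ℝ, 0 < δ ∧ ∀ x y, d.dist x v < δ → d.dist y v < δ →
      P x → Q y → ∃ z, Q z ∧ (∀ s : ℝ, 0 ≤ s → d.dist (φ s z) (φ s y) < η) ∧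
        Tendsto (fun s : ℝ => d.dist (φ s y) (φ s z)) atTop (𝓝 0) ∧
        ∃ r : ℝ, |r| < η ∧ (∀ s : ℝ, 0 ≤ s → d.dist (φ (-s) z) (φ (-s) (φ r x)) < η) ∧
          Tendsto (fun s : ℝ => d.dist (φ (-s) (φ r x)) (φ (-s) z)) atTop (𝓝 0)) :
    ∀ (m : ℕ) (v : Fin (m + 1) → X), (∀ i : Fin m, P (v i.castSucc)) → Q (v (Fin.last m)) →
      ∀ ε : ℝ, 0 < ε → ∃ δ : ℝ, 0 < δ ∧ ∀ t : Fin (m + 1) → ℝ, IsPseudoOrbit φ d.dist δ v t →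
        ∃ w, Q w ∧ Shadows φ d.dist ε v t w := by
  intro m
  induction m with
  | zero =>
    intro v _ hv ε hε
    -- A single infinite segment is shadowed by itself; `δ = 1` is arbitrary.
    refine ⟨1, one_pos, fun t _ => ⟨v 0, hv, ⟨0, by simpa using hε, ?_, ?_⟩, ⟨?_, ?_⟩, ?_,
      fun k => k.elim0, fun k => k.elim0, fun k => k.elim0⟩⟩
    · simp [strongUnstable, hzero]
    · simpa [hzero] using hε
    · simp [strongStable, Fin.last, startTime_zero, hzero]
    · simpa [Fin.last, startTime_zero, hzero] using hε
    · intro s _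
      simpa [Fin.last, startTime_zero] using hε
  | succ m ih =>
    intro v hPv hQv ε hε
    obtain ⟨δ₁, hδ₁, hbr⟩ := hbr (v 1) (ε / 2) (by positivity)
    obtain ⟨ρ, hρ, hsmall⟩ : ∃ ρ : ℝ, 0 < ρ ∧
        ∀ r : ℝ, |r| < ρ → d.dist (φ r (v 1)) (v 1) < δ₁ / 2 := by
      obtain ⟨ρ, hρ, h⟩ := Metric.eventually_nhds_iff.1
        ((hcont (v 1)).eventually_lt_const (half_pos hδ₁))
      exact ⟨ρ, hρ, fun r hr => h (by simpa using hr)⟩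
    -- The tail is shadowed finely enough that its shadow lies in the domain of the bracket at `v
    -- 1`, and that half of `ε` remains for the new bracket. No errors accumulate, because the
    -- precision is fixed before recursing into the tail.
    set ε' := min (ε / 2) (min ρ (δ₁ / 2)) with hε'
    have he1 : ε' ≤ ε / 2 := min_le_left _ _
    have he2 : ε' ≤ ρ := (min_le_right _ _).trans (min_le_left _ _)
    have he3 : ε' ≤ δ₁ / 2 := (min_le_right _ _).trans (min_le_right _ _)
    have hε'0 : 0 < ε' := by positivity
    obtain ⟨δ₂, hδ₂, hsh⟩ := ih (fun i => v i.succ) (fun i => hPv i.succ) hQv ε' hε'0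
    refine ⟨min δ₁ δ₂, lt_min hδ₁ hδ₂, fun t ht => ?_⟩
    obtain ⟨w', hQw', ⟨r', hr', -, hw'⟩, ⟨hst', hlast'⟩, hfut', τ', hτ', hmid'⟩ :=
      hsh (fun i => t i.succ)
        ⟨fun i => ht.1 _, fun i => (ht.2 i.succ).trans_le (min_le_right _ _)⟩
    have hw'1 : d.dist w' (v 1) < δ₁ := by
      have h1 := hsmall r' (hr'.trans_le he2)
      have h2 := dist_triangle w' (φ r' (v 1)) (v 1)
      have h3 : d.dist w' (φ r' (v 1)) < ε' := hw'
      exact h2.trans_lt (by linarith)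
    have hx1 : d.dist (φ (t 0) (v 0)) (v 1) < δ₁ := (ht.2 0).trans_le (min_le_left _ _)
    -- `z` has the past of the end of the first segment, shifted by `r`, and the future of `w'`.
    obtain ⟨z, hQz, hfwd, hfwd0, r, hr, hbwd, hbwd0⟩ :=
      hbr _ _ hx1 hw'1 (hP _ _ (hPv 0)) hQw'
    have hz : ∀ s, φ (t 0 + s) (φ (-t 0) z) = φ s z := fun s => by
      rw [hadd]
      congr 1
      ring
    have hlast : startTime t (Fin.last (m + 1)) =
        t 0 + startTime (fun i => t i.succ) (Fin.last m) := by
      rw [← Fin.succ_last, startTime_succ]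
    have hT : 0 ≤ startTime (fun i => t i.succ) (Fin.last m) :=
      Finset.sum_nonneg fun i _ => ht.1 _
    have hε2 : ∀ a b c : X, d.dist a b < ε / 2 → d.dist b c < ε' → d.dist a c < ε := by
      intro a b c h1 h2
      exact (dist_triangle a b c).trans_lt (by linarith)
    -- The shift of the first segment is `r`; the later segments keep the shifts of the tail, since
    -- `z` follows `w'` without a shift.
    refine ⟨φ (-t 0) z, hQ _ _ hQz, ⟨r, by linarith, ?_, ?_⟩, ⟨?_, ?_⟩, ?_, Fin.cons r τ', ?_, ?_⟩
    · have := hbwd0.comp (tendsto_atTop_add_const_right atTop (t 0) tendsto_id)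
      refine this.congr fun s => ?_
      simp only [Function.comp_apply, id, hadd]
      congr 2 <;> ring
    · have := hbwd (t 0) (ht.1 0)
      have e : φ (-t 0) (φ r (φ (t 0) (v 0))) = φ r (v 0) := by
        simp only [hadd]
        congr 1
        ring
      rw [e] at this
      linarith
    · rw [hlast, hz]
      have h1 := hfwd0.comp (tendsto_atTop_add_const_right atTop
        (startTime (fun i => t i.succ) (Fin.last m)) tendsto_id)
      have h2 := hst'.add h1
      rw [add_zero] at h2
      refine squeeze_zero (fun s => dist_nonneg) (fun s => ?_) h2
      simp only [Function.comp_apply, id, ← hadd s]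
      exact dist_triangle _ _ _
    · rw [hlast, hz]
      exact hε2 _ _ _ (hfwd _ hT) hlast'
    · intro s hs
      rw [hlast, add_assoc, hz]
      exact hε2 _ _ _ (hfwd _ (by positivity)) (hfut' s hs)
    · intro k
      refine Fin.cases ?_ (fun j => ?_) k
      · simp only [Fin.cons_zero]
        linarith
      · simp only [Fin.cons_succ]
        linarith [hτ' j]
    · intro k
      refine Fin.cases ?_ (fun j => ?_) k
      · intro s hs
        -- At time `s` of the first segment the orbit is still `t 0 - s` before `z`.
        have := hbwd (t 0 - s) (sub_nonneg.2 hs.2)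
        simp only [hadd] at this
        simp only [Fin.cons_zero, Fin.castSucc_zero, startTime_zero, hadd]
        have e1 : -(t 0 - s) = 0 + s + -t 0 := by ring
        have e2 : -(t 0 - s) + (r + t 0) = r + s := by ring
        rw [e2, e1] at this
        linarith
      · intro s hs
        have hT : 0 ≤ startTime (fun i => t i.succ) j.castSucc :=
          Finset.sum_nonneg fun i _ => ht.1 _
        simp only [Fin.cons_succ, Fin.castSucc_succ, startTime_succ, add_assoc, hz]
        exact hε2 _ _ _ (hfwd _ (add_nonneg hT hs.1)) (hmid' j s hs)

end Gluing

end HilbertGeometry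

end

/-! ### Weak orbit gluing for Benoist 3-manifolds -/

theorem mainTheorem8 (B : HilbertGeometry.Benoist3Manifold) (d : MetricSpace B.SM)
    (hd : d.toUniformSpace.toTopologicalSpace =
      B.topologicalSpaceSM) :
    HilbertGeometry.WeakOrbitGluing B.geodesicFlow d.dist
      (fun {m : ℕ} (v : Fin (m + 1) → B.SM) =>
        (∀ i : Fin m, B.IsBackwardRegular (v i.castSucc)) ∧
          B.IsForwardRegular (v (Fin.last m))) := by
  intro ε hε m v hv
  have hcont : ∀ v : B.SM, Tendsto (fun t => d.dist (B.geodesicFlow t v) v) (𝓝 0) (𝓝 0) := by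
    intro v
    refine HilbertGeometry.Benoist3Manifold.tendsto_dist d hd ?_
    have := (HilbertGeometry.Benoist3Manifold.continuous_geodesicFlow_time v).tendsto 0
    rwa [HilbertGeometry.Benoist3Manifold.geodesicFlow_zero] at this
  obtain ⟨δ, hδ, h⟩ := HilbertGeometry.exists_shadows_of_bracket d
    HilbertGeometry.Benoist3Manifold.geodesicFlow_add
    HilbertGeometry.Benoist3Manifold.geodesicFlow_zero hcont
    (fun _ t h => h.geodesicFlow t) (fun _ t h => h.geodesicFlow t)
    (fun v _ hη => HilbertGeometry.Benoist3Manifold.exists_bracket d hd v hη) m v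
    (fun i => (hv.1 i).backwardSmooth) hv.2.forwardSmooth ε hε
  refine ⟨δ, hδ, fun t ht => ?_⟩
  obtain ⟨w, -, hw⟩ := h t ht
  exact ⟨w, hw⟩
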